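/- Let $K\subset\mathbb{R}^3$ be a convex body, i.e. a compact convex set with nonempty interior, and suppose that $K=\operatorname{conv}(L\cup M)$ for two compact convex sets $L,M\subset\mathbb{R}^3$, both with empty interior. Let $c(K)$ be the least number of translates of the (relative) interior of $K$ needed to cover $K$. Then $c(K)$ is equal to the least number of smaller homothetic copies $x+\lambda K$ ($x\in\mathbb{R}^3$, $0<\lambda<1$) of $K$ needed to cover $K$, and $c(K)\le 8$. Moreover, $c(K)=8$ if and only if $K$ is a parallelepiped, that is, $K=\{p+t_1v_1+t_2v_2+t_3v_3 : 0\le t_i\le 1\}$ for some $p\in\mathbb{R}^3$ and some linearly independent $v_1,v_2,v_3\in\mathbb{R}^3$. -/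

import Mathlib

open scoped Pointwise

section HomotheticCovering

variable {E : Type*} [NormedAddCommGroup E] [NormedSpace ℝ E]

/-- A convex body: a compact convex set with nonempty interior. -/
structure IsConvexBody (K : Set E) : Prop where
  isCompact : IsCompact K
  convex : Convex ℝ K
  nonempty_interior : (interior K).Nonempty

/-- `C` is a smaller homothetic copy `x + r K` of `K`, with `0 < r < 1`. -/
def IsSmallerHomotheticCopy (K C : Set E) : Prop :=
  ∃ (x : E) (r : ℝ), 0 < r ∧ r < 1 ∧ C = x +ᵥ (r • K)

/-- `C` is a translate `x + relint K` of the relative interior of `K`. -/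
def IsTranslateOfRelInterior (K C : Set E) : Prop :=
  ∃ x : E, C = x +ᵥ intrinsicInterior ℝ K

/-- The least number of sets with property `P` needed to cover `K` (it is `⊤` if there is no
finite cover; an infimum of a nonempty family in `ℕ∞` is attained). -/
noncomputable def leastCoverCard (P : Set E → Prop) (K : Set E) : ℕ∞ :=
  ⨅ (𝒞 : Set (Set E)) (_ : (∀ C ∈ 𝒞, P C) ∧ K ⊆ ⋃₀ 𝒞), 𝒞.encard

/-- `c(K)`: the least number of translates of the relative interior of `K` needed to cover `K`. -/
noncomputable def coveringNumber (K : Set E) : ℕ∞ :=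
  leastCoverCard (IsTranslateOfRelInterior K) K

/-- The least number of smaller homothetic copies of `K` needed to cover `K`. -/
noncomputable def homotheticCoveringNumber (K : Set E) : ℕ∞ :=
  leastCoverCard (IsSmallerHomotheticCopy K) K

/-- A (nondegenerate) parallelepiped in a three-dimensional space:
`{p + t₀ v₀ + t₁ v₁ + t₂ v₂ | 0 ≤ tᵢ ≤ 1}` with `v₀, v₁, v₂` linearly independent. -/
def IsParallelepiped (K : Set (EuclideanSpace ℝ (Fin 3))) : Prop :=
  ∃ (p : EuclideanSpace ℝ (Fin 3)) (v : Fin 3 → EuclideanSpace ℝ (Fin 3)),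
    LinearIndependent ℝ v ∧ K = p +ᵥ parallelepiped v

end HomotheticCovering

/-! A direction illuminates a point of K if a ray from the point enters the interior of K. By
compactness, n directions illuminating K yield n translates of the interior that cover K. Finitely
many open translates covering K can be shrunk slightly, and each smaller copy lies in a translate of
the interior, so the two covering numbers agree. Directions that illuminate L and M also illuminate
the convex hull K.

A flat set such as L needs only three directions unless it is a parallelogram
(`illuminatedBy_three_or_parallelogram`). In the plane, take an inscribed triangle of maximal area.
If L extends beyond all three sides, each of three directions handles one cap and one vertex. If
some side lies on the boundary, L sits in a strip above that side; its top face is either shorter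
than the side, and three directions suffice, or equally long, and L is a parallelogram. A
parallelogram needs at most four directions, one per vertex, so c(K) ≤ 4 + 4.

If c(K) = 8, both L and M are parallelograms and seven directions do not illuminate K. Then no
direction illuminates two of the eight vertices together, so any two of them lie in parallel support
planes (`exists_antipodal_functional`). The resulting inequalities (`OpposedQuads`) leave two
configurations: two translated parallelograms, or two diagonal sections sharing a centre and an edge
direction. Both span a parallelepiped. Conversely, no translate of the interior of a parallelepiped
contains two of its vertices. -/

/-! ### Illumination, translates and homothetic copies -/

section Illumination

variable {E : Type*} [NormedAddCommGroup E] [NormedSpace ℝ E]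

/-- The direction `d` illuminates the point `x` of `K`: a ray from `x` in direction `d` enters
the interior of `K`. -/
def Illuminates (K : Set E) (d x : E) : Prop :=
  ∃ ε : ℝ, 0 < ε ∧ x + ε • d ∈ interior K

/-- All points of `A` are illuminated, as points of `K`, by at most `n` directions. -/
def IlluminatedBy (K A : Set E) (n : ℕ) : Prop :=
  ∃ D : Finset E, D.card ≤ n ∧ ∀ x ∈ A, ∃ d ∈ D, Illuminates K d x

theorem Convex.add_smul_mem_interior_of_le {K : Set E} (hK : Convex ℝ K) {x d : E} {ε ε' : ℝ}
    (hx : x ∈ K) (h : x + ε' • d ∈ interior K) (hε : 0 < ε) (hle : ε ≤ ε') :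
    x + ε • d ∈ interior K := by
  have hε' : 0 < ε' := hε.trans_le hle
  have := hK.combo_self_interior_mem_interior hx h (a := 1 - ε / ε') (b := ε / ε')
    (by rw [sub_nonneg]; exact (div_le_one hε').2 hle) (by positivity) (by ring)
  convert this using 1
  rw [smul_add, smul_smul, div_mul_cancel₀ _ hε'.ne', ← add_assoc, ← add_smul]
  simp

theorem IlluminatedBy.mono {K A B : Set E} {m n : ℕ} (h : IlluminatedBy K B m) (hAB : A ⊆ B)
    (hmn : m ≤ n) : IlluminatedBy K A n := by
  obtain ⟨D, hD, h⟩ := h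
  exact ⟨D, hD.trans hmn, fun x hx => h x (hAB hx)⟩

theorem IlluminatedBy.union {K A B : Set E} {m n : ℕ} (hA : IlluminatedBy K A m)
    (hB : IlluminatedBy K B n) : IlluminatedBy K (A ∪ B) (m + n) := by
  classical
  obtain ⟨D, hD, hA⟩ := hA
  obtain ⟨D', hD', hB⟩ := hB
  refine ⟨D ∪ D', (Finset.card_union_le _ _).trans (add_le_add hD hD'), ?_⟩
  rintro x (hx | hx)
  · obtain ⟨d, hd, h⟩ := hA x hx
    exact ⟨d, Finset.mem_union_left _ hd, h⟩
  · obtain ⟨d, hd, h⟩ := hB x hx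
    exact ⟨d, Finset.mem_union_right _ hd, h⟩

/-- A direction that illuminates one point of `K` illuminates every point of `K` that has it in a
convex combination with positive weight. -/
theorem Illuminates.combo {K : Set E} (hK : Convex ℝ K) {x y d : E} {a b : ℝ}
    (h : Illuminates K d x) (hy : y ∈ K) (ha : 0 < a) (hb : 0 ≤ b) (hab : a + b = 1) :
    Illuminates K d (a • x + b • y) := by
  obtain ⟨ε, hε, h⟩ := h
  refine ⟨a * ε, by positivity, ?_⟩
  convert hK.combo_interior_self_mem_interior h hy ha hb hab using 1
  module

/-- The points of K illuminated by a fixed set of directions form a convex set: a combination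
inherits a direction from any point of positive weight. -/
theorem IlluminatedBy.convexHull {K A : Set E} {n : ℕ} (hK : Convex ℝ K) (hAK : A ⊆ K)
    (h : IlluminatedBy K A n) : IlluminatedBy K (convexHull ℝ A) n := by
  obtain ⟨D, hD, h⟩ := h
  refine ⟨D, hD, fun x hx => ?_⟩
  have hsub : _root_.convexHull ℝ A ⊆ {x ∈ K | ∃ d ∈ D, Illuminates K d x} := by
    refine convexHull_min (fun y hy => ⟨hAK hy, h y hy⟩) ?_
    rintro y ⟨hy, d, hd, hyd⟩ z ⟨hz, d', hd', hzd⟩ a b ha hb hab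
    refine ⟨hK hy hz ha hb hab, ?_⟩
    rcases ha.eq_or_lt with rfl | ha
    · obtain rfl : b = 1 := by linarith
      exact ⟨d', hd', by simpa using hzd⟩
    · exact ⟨d, hd, hyd.combo hK hz ha hb hab⟩
  exact (hsub hx).2

/-- The set of points illuminated by a fixed direction is open. -/
theorem isOpen_illuminates (K : Set E) (d : E) : IsOpen {x | Illuminates K d x} := by
  have : {x | Illuminates K d x} = ⋃ ε : Set.Ioi (0 : ℝ), (fun x => x + (ε : ℝ) • d) ⁻¹' interior K := by
    ext x
    simp [Illuminates]
  rw [this]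
  exact isOpen_iUnion fun ε => isOpen_interior.preimage (by fun_prop)

/-- By compactness, an illuminated compact subset of `K` is covered by translates of the interior
of `K`. -/
theorem IlluminatedBy.exists_translates {K A : Set E} {n : ℕ} (hK : Convex ℝ K)
    (hA : IsCompact A) (hAK : A ⊆ K) (h : IlluminatedBy K A n) :
    ∃ X : Finset E, X.card ≤ n ∧ ∀ x ∈ A, ∃ y ∈ X, x - y ∈ interior K := by
  classical
  obtain ⟨D, hD, h⟩ := h
  obtain ⟨⟨ε, hε⟩, hcov⟩ := hA.elim_directed_cover (ι := Set.Ioi (0 : ℝ))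
    -- Allowing every step of length at least ε makes these open sets increase as ε decreases, so
    -- compactness gives one ε valid for all points.
    (fun ε => {x | ∃ d ∈ D, ∃ ε' : ℝ, (ε : ℝ) ≤ ε' ∧ x + ε' • d ∈ interior K})
    (fun ε => by
      have : {x | ∃ d ∈ D, ∃ ε' : ℝ, (ε : ℝ) ≤ ε' ∧ x + ε' • d ∈ interior K} =
          ⋃ d ∈ D, ⋃ ε' : Set.Ici (ε : ℝ), (fun x => x + (ε' : ℝ) • d) ⁻¹' interior K := by
        ext x
        simp
      rw [this]
      exact isOpen_biUnion fun d _ => isOpen_iUnion fun ε' =>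
        isOpen_interior.preimage (by fun_prop))
    (fun x hx => by
      obtain ⟨d, hd, ε, hε, hx⟩ := h x hx
      exact Set.mem_iUnion.2 ⟨⟨ε, hε⟩, d, hd, ε, le_rfl, hx⟩)
    (by
      rintro ⟨ε₁, h₁⟩ ⟨ε₂, h₂⟩
      refine ⟨⟨min ε₁ ε₂, Set.mem_Ioi.2 (lt_min h₁ h₂)⟩, ?_, ?_⟩
      · rintro x ⟨d, hd, ε', hle, hx⟩
        exact ⟨d, hd, ε', (min_le_left _ _).trans hle, hx⟩
      · rintro x ⟨d, hd, ε', hle, hx⟩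
        exact ⟨d, hd, ε', (min_le_right _ _).trans hle, hx⟩)
  refine ⟨D.image fun d => -(ε • d), Finset.card_image_le.trans hD, fun x hx => ?_⟩
  obtain ⟨d, hd, ε', hle, hx'⟩ := hcov hx
  refine ⟨_, Finset.mem_image_of_mem _ hd, ?_⟩
  rw [sub_neg_eq_add]
  exact hK.add_smul_mem_interior_of_le (hAK hx) hx' hε hle

/-- Finitely many translates of the interior of `K` that cover a compact set can be replaced by
smaller homothetic copies of `K` with the same ratio. -/
theorem IsCompact.exists_homothets_of_translates {K A : Set E} (hK : Convex ℝ K)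
    (hA : IsCompact A) {o : E} (ho : o ∈ interior K) (X : Finset E)
    (h : ∀ x ∈ A, ∃ y ∈ X, x - y ∈ interior K) :
    ∃ r : ℝ, 0 < r ∧ r < 1 ∧ ∀ x ∈ A, ∃ y ∈ X, ∃ k ∈ K, x = y + ((1 - r) • o + r • k) := by
  -- The homothets of the interior with centre o grow with their ratio, which makes the open cover
  -- directed.
  have hmono : ∀ {r s : ℝ}, 0 < r → r ≤ s → ∀ {x : E}, o + r⁻¹ • (x - o) ∈ interior K →
      o + s⁻¹ • (x - o) ∈ interior K := by
    intro r s hr hrs x hx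
    exact hK.add_smul_mem_interior_of_le (interior_subset ho) hx
      (inv_pos.2 (hr.trans_le hrs)) (inv_anti₀ hr hrs)
  obtain ⟨⟨r, hr0, hr1⟩, hcov⟩ := hA.elim_directed_cover (ι := Set.Ioo (0 : ℝ) 1)
    (hι := ⟨⟨1 / 2, by norm_num, by norm_num⟩⟩)
    (fun r => {x | ∃ y ∈ X, o + (r : ℝ)⁻¹ • (x - y - o) ∈ interior K})
    (fun r => by
      have : {x | ∃ y ∈ X, o + (r : ℝ)⁻¹ • (x - y - o) ∈ interior K} =
          ⋃ y ∈ X, (fun x => o + (r : ℝ)⁻¹ • (x - y - o)) ⁻¹' interior K := by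
        ext x
        simp
      rw [this]
      exact isOpen_biUnion fun d _ => isOpen_interior.preimage (by fun_prop))
    (fun x hx => by
      obtain ⟨y, hy, hxy⟩ := h x hx
      have hcont : ContinuousAt (fun r : ℝ => o + r⁻¹ • (x - y - o)) 1 := by
        have : ContinuousAt (fun r : ℝ => r⁻¹) 1 := continuousAt_inv₀ one_ne_zero
        fun_prop
      have h1 : o + (1 : ℝ)⁻¹ • (x - y - o) ∈ interior K := by simpa using hxy
      have hev := hcont.eventually (isOpen_interior.eventually_mem h1)
      have hev' : ∀ᶠ r in nhdsWithin (1 : ℝ) (Set.Iio 1),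
          o + r⁻¹ • (x - y - o) ∈ interior K ∧ r ∈ Set.Ioo (0 : ℝ) 1 :=
        (hev.filter_mono nhdsWithin_le_nhds).and (Ioo_mem_nhdsLT one_pos)
      obtain ⟨r, hr, hr'⟩ := hev'.exists
      exact Set.mem_iUnion.2 ⟨⟨r, hr'⟩, y, hy, hr⟩)
    (by
      rintro ⟨r, hr⟩ ⟨s, hs⟩
      refine ⟨⟨max r s, lt_max_of_lt_left hr.1, max_lt hr.2 hs.2⟩, ?_, ?_⟩
      · rintro x ⟨y, hy, hx⟩
        exact ⟨y, hy, hmono hr.1 (le_max_left _ _) hx⟩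
      · rintro x ⟨y, hy, hx⟩
        exact ⟨y, hy, hmono hs.1 (le_max_right _ _) hx⟩)
  refine ⟨r, hr0, hr1, fun x hx => ?_⟩
  obtain ⟨y, hy, hxy⟩ := hcov hx
  refine ⟨y, hy, _, interior_subset hxy, ?_⟩
  rw [smul_add, smul_smul, mul_inv_cancel₀ hr0.ne']
  module

/-- Illumination of a body within an affine chart gives illumination of its image within any
convex set with interior points. -/
theorem IlluminatedBy.image {F : Type*} [NormedAddCommGroup F] [NormedSpace ℝ F]
    {L : Set F} {K : Set E} {n : ℕ} (hL : Convex ℝ L) (hLc : IsCompact L)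
    (hLo : (interior L).Nonempty) (h : IlluminatedBy L L n) (hK : Convex ℝ K)
    (hKo : (interior K).Nonempty) (e : F →ₗ[ℝ] E) (p : E) (hsub : ∀ z ∈ L, p + e z ∈ K) :
    IlluminatedBy K ((fun z => p + e z) '' L) n := by
  classical
  obtain ⟨X, hX, hcov⟩ := h.exists_translates hL hLc subset_rfl
  obtain ⟨q, hq⟩ := hLo
  obtain ⟨o, ho⟩ := hKo
  obtain ⟨r, hr0, hr1, hr⟩ := hLc.exists_homothets_of_translates hL hq X hcov
  -- With z = y + (1 - r)q + rk, this direction carries p + e z to r(p + e k) + (1 - r)o, which is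
  -- interior to K.
  refine ⟨X.image fun y => (1 - r) • (o - p) - e (y + (1 - r) • q),
    Finset.card_image_le.trans hX, ?_⟩
  rintro _ ⟨z, hz, rfl⟩
  obtain ⟨y, hy, k, hk, rfl⟩ := hr z hz
  refine ⟨_, Finset.mem_image_of_mem _ hy, 1, one_pos, ?_⟩
  convert hK.combo_self_interior_mem_interior (hsub k hk) ho hr0.le (sub_pos.2 hr1)
    (by ring) using 1
  simp only [map_add, map_smul]
  module

theorem IsConvexBody.intrinsicInterior_eq {K : Set E} (hK : IsConvexBody K) :
    intrinsicInterior ℝ K = interior K := by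
  refine Set.Subset.antisymm ?_ interior_subset_intrinsicInterior
  have htop : affineSpan ℝ K = ⊤ := affineSpan_eq_top_of_nonempty_interior
    (hK.nonempty_interior.mono (interior_mono (subset_convexHull ℝ K)))
  have hopen : IsOpen ((affineSpan ℝ K : AffineSubspace ℝ E) : Set E) := by
    rw [htop]; exact isOpen_univ
  refine interior_maximal intrinsicInterior_subset ?_
  exact hopen.isOpenMap_subtype_val _ isOpen_interior

theorem IsConvexBody.coveringNumber_le {K : Set E} (hK : IsConvexBody K) {n : ℕ}
    (h : IlluminatedBy K K n) : coveringNumber K ≤ n := by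
  obtain ⟨X, hX, hcov⟩ := h.exists_translates hK.convex hK.isCompact subset_rfl
  have : coveringNumber K ≤ ((fun y : E => y +ᵥ interior K) '' (X : Set E)).encard := by
    refine iInf₂_le _ ⟨?_, ?_⟩
    · rintro _ ⟨y, -, rfl⟩
      exact ⟨y, by rw [hK.intrinsicInterior_eq]⟩
    · intro x hx
      obtain ⟨y, hy, hxy⟩ := hcov x hx
      refine ⟨_, ⟨y, hy, rfl⟩, x - y, hxy, ?_⟩
      simp
  refine this.trans ((Set.encard_image_le _ _).trans ?_)
  rw [Set.encard_coe_eq_coe_finsetCard]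
  exact_mod_cast hX

/-- A copy x + rK, moved by (1 - r)o with o interior, lies in the interior of K translated by x. In
the other direction only finite covers matter, and compactness gives a common ratio below 1. -/
theorem IsConvexBody.coveringNumber_eq_homotheticCoveringNumber {K : Set E}
    (hK : IsConvexBody K) : coveringNumber K = homotheticCoveringNumber K := by
  classical
  obtain ⟨o, ho⟩ := hK.nonempty_interior
  apply le_antisymm
  · refine le_iInf₂ fun 𝒞 h𝒞 => ?_
    have hch : ∀ C ∈ 𝒞, ∃ y : E, C ⊆ y +ᵥ interior K := by
      intro C hC
      obtain ⟨x, r, hr0, hr1, rfl⟩ := h𝒞.1 C hC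
      refine ⟨x - (1 - r) • o, ?_⟩
      rintro _ ⟨_, ⟨k, hk, rfl⟩, rfl⟩
      refine ⟨(1 - r) • o + r • k, hK.convex.combo_interior_self_mem_interior ho hk
        (sub_pos.2 hr1) hr0.le (by ring), ?_⟩
      simp only [vadd_eq_add]
      module
    choose! y hy using hch
    have : coveringNumber K ≤ ((fun C => y C +ᵥ interior K) '' 𝒞).encard := by
      refine iInf₂_le _ ⟨?_, ?_⟩
      · rintro _ ⟨C, -, rfl⟩
        exact ⟨y C, by rw [hK.intrinsicInterior_eq]⟩
      · intro x hx
        obtain ⟨C, hC, hxC⟩ := h𝒞.2 hx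
        exact ⟨_, ⟨C, hC, rfl⟩, hy C hC hxC⟩
    exact this.trans (Set.encard_image_le _ _)
  · refine le_iInf₂ fun 𝒞 h𝒞 => ?_
    by_cases hfin : 𝒞.Finite
    swap
    · rw [Set.encard_eq_top_iff.2 hfin]
      exact le_top
    have hch : ∀ C ∈ 𝒞, ∃ y : E, C = y +ᵥ interior K := by
      intro C hC
      obtain ⟨x, hx⟩ := h𝒞.1 C hC
      exact ⟨x, by rw [hx, hK.intrinsicInterior_eq]⟩
    choose! y hy using hch
    obtain ⟨r, hr0, hr1, hr⟩ := hK.isCompact.exists_homothets_of_translates hK.convex ho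
      (hfin.toFinset.image y) (fun x hx => by
        obtain ⟨C, hC, hxC⟩ := h𝒞.2 hx
        rw [hy C hC] at hxC
        obtain ⟨k, hk, rfl⟩ := hxC
        exact ⟨y C, Finset.mem_image_of_mem _ (hfin.mem_toFinset.2 hC), by simpa using hk⟩)
    have : homotheticCoveringNumber K ≤
        ((fun C => (y C + (1 - r) • o) +ᵥ (r • K)) '' 𝒞).encard := by
      refine iInf₂_le _ ⟨?_, ?_⟩
      · rintro _ ⟨C, -, rfl⟩
        exact ⟨_, r, hr0, hr1, rfl⟩
      · intro x hx
        obtain ⟨z, hz, k, hk, rfl⟩ := hr x hx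
        obtain ⟨C, hC, rfl⟩ := Finset.mem_image.1 hz
        refine ⟨_, ⟨C, hfin.mem_toFinset.1 hC, rfl⟩, r • k, ⟨k, hk, rfl⟩, ?_⟩
        simp only [vadd_eq_add]
        abel
    exact this.trans (Set.encard_image_le _ _)

end Illumination

/-! ### Planar sets: triangles of maximal area and strips -/

section Planar

/-- Twice the signed area of the triangle `a b c`. -/
def signedArea (a b c : ℝ × ℝ) : ℝ :=
  (b.1 - a.1) * (c.2 - a.2) - (b.2 - a.2) * (c.1 - a.1)

theorem signedArea_rotate (a b c : ℝ × ℝ) : signedArea b c a = signedArea a b c := by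
  simp only [signedArea]; ring

theorem signedArea_swap (a b c : ℝ × ℝ) : signedArea a c b = -signedArea a b c := by
  simp only [signedArea]; ring

/-- Barycentric coordinates with respect to a nondegenerate triangle. -/
theorem exists_barycentric {a b c : ℝ × ℝ} (h : signedArea a b c ≠ 0) (x : ℝ × ℝ) :
    ∃ l₁ l₂ l₃ : ℝ, l₁ + l₂ + l₃ = 1 ∧ x = l₁ • a + l₂ • b + l₃ • c ∧
      signedArea x b c = l₁ * signedArea a b c ∧ signedArea a x c = l₂ * signedArea a b c ∧
      signedArea a b x = l₃ * signedArea a b c := by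
  refine ⟨signedArea x b c / signedArea a b c, signedArea a x c / signedArea a b c,
    signedArea a b x / signedArea a b c, ?_, ?_, (div_mul_cancel₀ _ h).symm,
    (div_mul_cancel₀ _ h).symm, (div_mul_cancel₀ _ h).symm⟩
  · rw [← add_div, ← add_div, div_eq_one_iff_eq h]
    simp only [signedArea]; ring
  · ext
    · simp only [Prod.fst_add, Prod.smul_fst, smul_eq_mul]
      field_simp
      simp only [signedArea]; ring
    · simp only [Prod.snd_add, Prod.smul_snd, smul_eq_mul]
      field_simp
      simp only [signedArea]; ring

theorem Convex.combo_mem_of_three {E : Type*} [AddCommGroup E] [Module ℝ E] {L : Set E}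
    (hL : Convex ℝ L) {a b c : E} (ha : a ∈ L) (hb : b ∈ L) (hc : c ∈ L) {l₁ l₂ l₃ : ℝ}
    (h₁ : 0 ≤ l₁) (h₂ : 0 ≤ l₂) (h₃ : 0 ≤ l₃) (hsum : l₁ + l₂ + l₃ = 1) :
    l₁ • a + l₂ • b + l₃ • c ∈ L := by
  have := hL.sum_mem (t := Finset.univ) (w := ![l₁, l₂, l₃]) (z := ![a, b, c])
    (by intro i _; fin_cases i <;> simpa) (by simp [Fin.sum_univ_three, hsum])
    (by intro i _; fin_cases i <;> simpa)
  simpa [Fin.sum_univ_three] using this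

/-- The points with all three barycentric coordinates positive form an open set contained in L. -/
theorem combo_mem_interior_of_signedArea_ne_zero {L : Set (ℝ × ℝ)} (hL : Convex ℝ L)
    {a b c : ℝ × ℝ} (ha : a ∈ L) (hb : b ∈ L) (hc : c ∈ L) (h : signedArea a b c ≠ 0)
    {l₁ l₂ l₃ : ℝ} (h₁ : 0 < l₁) (h₂ : 0 < l₂) (h₃ : 0 < l₃) (hsum : l₁ + l₂ + l₃ = 1) :
    l₁ • a + l₂ • b + l₃ • c ∈ interior L := by
  refine interior_maximal (t := {x | 0 < signedArea x b c / signedArea a b c ∧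
    0 < signedArea a x c / signedArea a b c ∧ 0 < signedArea a b x / signedArea a b c}) ?_ ?_ ?_
  · rintro x ⟨hx₁, hx₂, hx₃⟩
    obtain ⟨m₁, m₂, m₃, hm, rfl, e₁, e₂, e₃⟩ := exists_barycentric h x
    rw [e₁, mul_div_cancel_right₀ _ h] at hx₁
    rw [e₂, mul_div_cancel_right₀ _ h] at hx₂
    rw [e₃, mul_div_cancel_right₀ _ h] at hx₃
    exact hL.combo_mem_of_three ha hb hc hx₁.le hx₂.le hx₃.le hm
  · have hc₁ : Continuous fun x => signedArea x b c / signedArea a b c := by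
      simp only [signedArea]; fun_prop
    have hc₂ : Continuous fun x => signedArea a x c / signedArea a b c := by
      simp only [signedArea]; fun_prop
    have hc₃ : Continuous fun x => signedArea a b x / signedArea a b c := by
      simp only [signedArea]; fun_prop
    exact (isOpen_lt continuous_const hc₁).inter
      ((isOpen_lt continuous_const hc₂).inter (isOpen_lt continuous_const hc₃))
  · obtain rfl : l₁ = 1 - l₂ - l₃ := by linarith
    refine ⟨?_, ?_, ?_⟩
    · convert h₁ using 1
      rw [div_eq_iff h]
      simp [signedArea]; ring
    · convert h₂ using 1
      rw [div_eq_iff h]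
      simp [signedArea]; ring
    · convert h₃ using 1
      rw [div_eq_iff h]
      simp [signedArea]; ring

/-- In a triangle of maximal area inscribed in `L`, if `L` has points beyond the side `p₃p₁`, then
one direction illuminates `p₃` and everything beyond the side `p₂p₃`. -/
theorem exists_illuminates_cap {L : Set (ℝ × ℝ)} (hL : Convex ℝ L) {p₁ p₂ p₃ q : ℝ × ℝ}
    (h₁ : p₁ ∈ L) (h₂ : p₂ ∈ L) (h₃ : p₃ ∈ L) (hq : q ∈ L) (hpos : 0 < signedArea p₁ p₂ p₃)
    (hmax : ∀ a ∈ L, ∀ b ∈ L, ∀ c ∈ L, signedArea a b c ≤ signedArea p₁ p₂ p₃)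
    (hneg : signedArea p₁ q p₃ < 0) :
    ∃ d, (∀ x ∈ L, signedArea x p₂ p₃ < 0 → Illuminates L d x) ∧ Illuminates L d p₃ := by
  obtain ⟨q₁, q₂, q₃, hqs, hqe, e₁, e₂, -⟩ := exists_barycentric hpos.ne' q
  have hq₁ : q₁ ≤ 1 := by
    have := hmax q hq p₂ h₂ p₃ h₃
    rw [e₁] at this
    nlinarith
  have hq₂ : 0 < -q₂ := by
    rw [e₂] at hneg
    by_contra! hcon
    nlinarith
  obtain ⟨τ, hτ0, hτ1, hτq⟩ : ∃ τ : ℝ, 0 < τ ∧ τ ≤ 1 / 2 ∧ τ * -q₂ ≤ 1 / 2 := by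
    refine ⟨min (1 / 2) (1 / (2 * -q₂)), by positivity, min_le_left _ _, ?_⟩
    calc _ ≤ 1 / (2 * -q₂) * -q₂ := mul_le_mul_of_nonneg_right (min_le_right _ _) hq₂.le
      _ = 1 / 2 := by have := (neg_pos.1 hq₂).ne; field_simp
  obtain ⟨t, ht⟩ : ∃ t : ℝ, t = τ * -q₂ := ⟨_, rfl⟩
  have ht0 : 0 < t := ht ▸ mul_pos hτ0 hq₂
  have ht1 : t ≤ 1 / 2 := ht ▸ hτq
  -- The direction points from a point of the open side p₂p₃, close to p₃ for small t, towards p₁.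
  -- Taking t = -τq₂ lets its p₂ term be rewritten through q.
  refine ⟨p₁ - t • p₂ - (1 - t) • p₃, ?_, ?_⟩
  · intro x hx hxneg
    obtain ⟨l₁, l₂, l₃, hs, hxe, f₁, f₂, f₃⟩ := exists_barycentric hpos.ne' x
    have hl₁ : l₁ < 0 := by
      rw [f₁] at hxneg
      by_contra! hcon
      nlinarith
    have hl₂ : l₂ ≤ 1 := by
      have := hmax p₁ h₁ x hx p₃ h₃
      rw [f₂] at this
      nlinarith
    have hl₃ : l₃ ≤ 1 := by
      have := hmax p₁ h₁ p₂ h₂ x hx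
      rw [f₃] at this
      nlinarith
    -- This step turns the p₁ coordinate into -l₁t > 0. Maximality gives l₂, l₃ ≤ 1, hence l₂, l₃ ≥
    -- -l₁, and t ≤ 1/2 keeps the other coordinates positive.
    refine ⟨-l₁ * (1 + t), mul_pos (neg_pos.2 hl₁) (by linarith), ?_⟩
    have := combo_mem_interior_of_signedArea_ne_zero hL h₁ h₂ h₃ hpos.ne'
      (l₁ := -l₁ * t) (l₂ := l₂ + l₁ * (1 + t) * t) (l₃ := l₃ + l₁ * (1 + t) * (1 - t))
      (mul_pos (neg_pos.2 hl₁) ht0)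
      (by nlinarith [mul_pos (neg_pos.2 hl₁) (show 0 < 1 - (1 + t) * t by nlinarith)])
      (by nlinarith [mul_pos (neg_pos.2 hl₁) (mul_pos ht0 ht0)])
      (by linear_combination hs)
    convert this using 1
    rw [hxe]
    module
  · have hτq₁ : 0 ≤ τ * (1 - q₁) := mul_nonneg hτ0.le (by linarith)
    -- In terms of the triangle p₁, p₃, q, this s leaves weight 1/2 on p₃; the other weights are
    -- positive because q₁ ≤ 1 and τ ≤ 1/2.
    obtain ⟨s, hs⟩ : ∃ s : ℝ, s = 1 / (2 * (1 + τ * (1 - q₁))) := ⟨_, rfl⟩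
    have hs0 : 0 < s := by rw [hs]; positivity
    have hsk : s * (1 + τ * (1 - q₁)) = 1 / 2 := by rw [hs]; field_simp
    refine ⟨s, hs0, ?_⟩
    have hne : signedArea p₁ p₃ q ≠ 0 := by
      rw [signedArea_swap]
      linarith
    have := combo_mem_interior_of_signedArea_ne_zero hL h₁ h₃ hq hne
      (l₁ := s * (1 - τ * q₁)) (l₂ := 1 - s * (1 + τ * (1 - q₁))) (l₃ := s * τ)
      (mul_pos hs0 (by nlinarith)) (by rw [hsk]; norm_num) (by positivity) (by ring)
    convert this using 1
    obtain rfl : q₃ = 1 - q₁ - q₂ := by linarith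
    rw [hqe, ht]
    module

/-- If a triangle of maximal area inscribed in `L` has points of `L` beyond each of its sides, then
three directions illuminate `L`. -/
theorem illuminatedBy_three_of_caps {L : Set (ℝ × ℝ)} (hL : Convex ℝ L)
    {p₁ p₂ p₃ q₁ q₂ q₃ : ℝ × ℝ} (h₁ : p₁ ∈ L) (h₂ : p₂ ∈ L) (h₃ : p₃ ∈ L)
    (hpos : 0 < signedArea p₁ p₂ p₃)
    (hmax : ∀ a ∈ L, ∀ b ∈ L, ∀ c ∈ L, signedArea a b c ≤ signedArea p₁ p₂ p₃)
    (hq₁ : q₁ ∈ L) (hneg₁ : signedArea p₂ p₃ q₁ < 0) (hq₂ : q₂ ∈ L)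
    (hneg₂ : signedArea p₃ p₁ q₂ < 0) (hq₃ : q₃ ∈ L) (hneg₃ : signedArea p₁ p₂ q₃ < 0) :
    IlluminatedBy L L 3 := by
  classical
  have hr := signedArea_rotate p₁ p₂ p₃
  have hr' := signedArea_rotate p₂ p₃ p₁
  obtain ⟨d₁, hd₁, hd₁'⟩ := exists_illuminates_cap hL h₁ h₂ h₃ hq₂ hpos hmax
    (by rwa [signedArea_rotate p₃ p₁ q₂])
  obtain ⟨d₂, hd₂, hd₂'⟩ := exists_illuminates_cap hL h₂ h₃ h₁ hq₃ (by linarith)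
    (by rwa [hr]) (by rwa [signedArea_rotate p₁ p₂ q₃])
  obtain ⟨d₃, hd₃, hd₃'⟩ := exists_illuminates_cap hL h₃ h₁ h₂ hq₁ (by linarith)
    (by rwa [hr', hr]) (by rwa [signedArea_rotate p₂ p₃ q₁])
  let A : Set (ℝ × ℝ) := {x ∈ L | ∃ d ∈ ({d₁, d₂, d₃} : Finset (ℝ × ℝ)), Illuminates L d x}
  have hA : IlluminatedBy L A 3 :=
    ⟨{d₁, d₂, d₃}, Finset.card_le_three, fun x hx => hx.2⟩
  refine (hA.convexHull hL fun x hx => hx.1).mono (fun x hx => ?_) le_rfl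
  by_cases hx₁ : signedArea x p₂ p₃ < 0
  · exact subset_convexHull ℝ A ⟨hx, d₁, by simp, hd₁ x hx hx₁⟩
  by_cases hx₂ : signedArea x p₃ p₁ < 0
  · exact subset_convexHull ℝ A ⟨hx, d₂, by simp, hd₂ x hx hx₂⟩
  by_cases hx₃ : signedArea x p₁ p₂ < 0
  · exact subset_convexHull ℝ A ⟨hx, d₃, by simp, hd₃ x hx hx₃⟩
  -- A point in none of the caps lies in the triangle, and all three vertices are illuminated.
  obtain ⟨l₁, l₂, l₃, hs, hxe, f₁, f₂, f₃⟩ := exists_barycentric hpos.ne' x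
  rw [← signedArea_rotate p₁ x p₃] at f₂
  rw [signedArea_rotate x p₁ p₂] at f₃
  have hp₁ : p₁ ∈ A := ⟨h₁, d₂, by simp, hd₂'⟩
  have hp₂ : p₂ ∈ A := ⟨h₂, d₃, by simp, hd₃'⟩
  have hp₃ : p₃ ∈ A := ⟨h₃, d₁, by simp, hd₁'⟩
  rw [hxe]
  refine (convex_convexHull ℝ A).combo_mem_of_three (subset_convexHull ℝ A hp₁)
    (subset_convexHull ℝ A hp₂) (subset_convexHull ℝ A hp₃) ?_ ?_ ?_ hs
  all_goals
    by_contra! hcon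
    nlinarith

/-- A planar compact convex set in the strip `0 ≤ y ≤ 1`, with an edge `[0, 1] × {0}` at the bottom
and a strictly shorter face at the top, is illuminated by three directions. -/
theorem illuminatedBy_three_of_strip {L : Set (ℝ × ℝ)} (hL : Convex ℝ L) (hLc : IsCompact L)
    (h₀ : ((0, 0) : ℝ × ℝ) ∈ L) (h₁ : ((1, 0) : ℝ × ℝ) ∈ L) {α w : ℝ} (hα : ((α, 1) : ℝ × ℝ) ∈ L)
    (hstrip : ∀ z ∈ L, 0 ≤ z.2 ∧ z.2 ≤ 1) (hw : ∀ z ∈ L, z.2 = 1 → 0 < z.1 + w ∧ z.1 + w < 1) :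
    IlluminatedBy L L 3 := by
  classical
  -- The full step lands in the open bottom edge, so half of it is already interior.
  have htop : ∀ z ∈ L, z.2 = 1 → Illuminates L (w, -1) z := by
    intro z hz hz1
    obtain ⟨hw0, hw1⟩ := hw z hz hz1
    have := combo_mem_interior_of_signedArea_ne_zero hL h₀ h₁ hz
      (by simp [signedArea, hz1]) (l₁ := (1 - (z.1 + w)) / 2) (l₂ := (z.1 + w) / 2) (l₃ := 1 / 2)
      (by linarith) (by linarith) (by norm_num) (by ring)
    refine ⟨1 / 2, by norm_num, ?_⟩
    convert this using 1
    ext <;> simp [hz1] <;> ring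
  -- The points missed by (w, -1) form a compact set avoiding the top, so they stay a definite
  -- height η below it.
  obtain ⟨η, hη0, hη⟩ : ∃ η : ℝ, 0 < η ∧ ∀ z ∈ L, ¬ Illuminates L (w, -1) z → z.2 ≤ 1 - η := by
    have hc : IsCompact (L \ {x | Illuminates L (w, -1) x}) :=
      hLc.diff (isOpen_illuminates _ _)
    rcases (L \ {x | Illuminates L (w, -1) x}).eq_empty_or_nonempty with he | hne
    · refine ⟨1, one_pos, fun z hz hz' => ?_⟩
      have : z ∈ L \ {x | Illuminates L (w, -1) x} := ⟨hz, hz'⟩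
      rw [he] at this
      exact this.elim
    · obtain ⟨z₀, hz₀, hmax⟩ := hc.exists_isMaxOn hne (f := Prod.snd) (by fun_prop)
      refine ⟨1 - z₀.2, ?_, fun z hz hz' => ?_⟩
      · have := (hstrip z₀ hz₀.1).2
        rcases this.lt_or_eq with h | h
        · linarith
        · exact (hz₀.2 (htop z₀ hz₀.1 h)).elim
      · have := hmax (show z ∈ L \ {x | Illuminates L (w, -1) x} from ⟨hz, hz'⟩)
        simp only [Set.mem_ofPred_eq] at this
        linarith
  obtain ⟨B, hB⟩ := hLc.isBounded.exists_norm_le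
  have hB' : ∀ z ∈ L, |z.1| ≤ B := fun z hz => (norm_fst_le z).trans (hB z hz)
  have hB0 : 0 ≤ B := (abs_nonneg _).trans (hB' _ h₀)
  have hαB := hB' _ hα
  simp only at hαB
  obtain ⟨hαB1, hαB2⟩ := abs_le.1 hαB
  -- The upward drift over a step of length at most 2B + 1 is so small that it costs at most η/8,
  -- less than the margin (1 - y)/4 ≥ η/4 available in the triangle.
  obtain ⟨δ, hδ⟩ : ∃ δ : ℝ, δ = η / (8 * (1 + B) * (2 * B + 1)) := ⟨_, rfl⟩
  have hδ0 : 0 < δ := by rw [hδ]; positivity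
  have hδη : (1 + B) * (2 * B + 1) * δ = η / 8 := by rw [hδ]; field_simp
  have key : ∀ z ∈ L, ∀ s e : ℝ, 0 < s → s ≤ 2 * B + 1 → 0 ≤ z.2 → z.2 ≤ 1 - η →
      (1 - z.2) / 4 ≤ z.1 + s * e - z.2 * α → z.1 + s * e - z.2 * α ≤ 3 * (1 - z.2) / 4 →
      Illuminates L (e, δ) z := by
    intro z hz s e hs hsB hz0 hzη hl hr
    have hsδ : (1 + B) * (s * δ) ≤ η / 8 := by
      rw [← hδη, ← mul_assoc]
      gcongr
    have hsδ0 : 0 < s * δ := by positivity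
    have h4 : α * (s * δ) ≤ B * (s * δ) := by gcongr
    have h5 : -B * (s * δ) ≤ α * (s * δ) := by gcongr
    refine ⟨s, hs, ?_⟩
    have := combo_mem_interior_of_signedArea_ne_zero hL h₀ h₁ hα
      (by simp [signedArea])
      (l₁ := 1 - (z.2 + s * δ) - (z.1 + s * e - (z.2 + s * δ) * α))
      (l₂ := z.1 + s * e - (z.2 + s * δ) * α) (l₃ := z.2 + s * δ)
      (by nlinarith) (by nlinarith) (by positivity) (by ring)
    convert this using 1
    ext <;> simp
  refine ⟨{(w, -1), (1, δ), (-1, δ)}, Finset.card_le_three, fun z hz => ?_⟩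
  by_cases hzt : Illuminates L (w, -1) z
  · exact ⟨_, by simp, hzt⟩
  have hzη := hη z hz hzt
  have hz0 := (hstrip z hz).1
  obtain ⟨hzB1, hzB2⟩ := abs_le.1 (hB' z hz)
  have hm1 : z.2 * α ≤ B := by nlinarith
  have hm2 : -B ≤ z.2 * α := by nlinarith
  -- At height y the triangle occupies [yα, yα + 1 - y]. Each point is aimed at the quarter point
  -- beyond the midpoint, so the step has positive length.
  rcases le_total z.1 (z.2 * α + (1 - z.2) / 2) with hle | hle
  · refine ⟨(1, δ), by simp, key z hz (z.2 * α + 3 * (1 - z.2) / 4 - z.1) 1 ?_ ?_ hz0 hzη ?_ ?_⟩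
    all_goals linarith
  · refine ⟨(-1, δ), by simp, key z hz (z.1 - z.2 * α - (1 - z.2) / 4) (-1) ?_ ?_ hz0 hzη ?_ ?_⟩
    all_goals linarith

end Planar

/-! ### The planar trichotomy: segment, three directions, or parallelogram -/

section Planar

/-- Maximality bounds the height and the length β - α of the top face by 1. A shorter face can be
shifted strictly inside the bottom edge. If β - α = 1, two further triangles bound L by the lines
joining corresponding endpoints of the two faces. -/
theorem strip_or_parallelogram {L : Set (ℝ × ℝ)} (hL : Convex ℝ L) (hLc : IsCompact L)
    (h₀ : ((0, 0) : ℝ × ℝ) ∈ L) (h₁ : ((1, 0) : ℝ × ℝ) ∈ L) (h₂ : ((0, 1) : ℝ × ℝ) ∈ L)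
    (hmax : ∀ a ∈ L, ∀ b ∈ L, ∀ c ∈ L, signedArea a b c ≤ 1) (hnonneg : ∀ z ∈ L, 0 ≤ z.2) :
    IlluminatedBy L L 3 ∨ ∃ α : ℝ, (α, 1) ∈ L ∧ (α + 1, 1) ∈ L ∧
      ∀ z ∈ L, z.2 ≤ 1 ∧ α * z.2 ≤ z.1 ∧ z.1 ≤ α * z.2 + 1 := by
  have hstrip : ∀ z ∈ L, 0 ≤ z.2 ∧ z.2 ≤ 1 := fun z hz =>
    ⟨hnonneg z hz, by simpa [signedArea] using hmax _ h₀ _ h₁ z hz⟩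
  have hTc : IsCompact (L ∩ {z | z.2 = 1}) :=
    hLc.inter_right (isClosed_eq continuous_snd continuous_const)
  have hTne : (L ∩ {z | z.2 = 1}).Nonempty := ⟨_, h₂, rfl⟩
  obtain ⟨⟨α, _⟩, ⟨hα, rfl⟩, hmin⟩ := hTc.exists_isMinOn hTne (f := Prod.fst) (by fun_prop)
  obtain ⟨⟨β, _⟩, ⟨hβ, rfl⟩, hmx⟩ := hTc.exists_isMaxOn hTne (f := Prod.fst) (by fun_prop)
  have hle : β - α ≤ 1 := by simpa [signedArea] using hmax _ h₀ _ hβ _ hα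
  rcases hle.lt_or_eq with hlt | heq
  · left
    refine illuminatedBy_three_of_strip hL hLc h₀ h₁ hα (w := (1 - (β + α)) / 2) hstrip ?_
    intro z hz hz1
    have h1 : α ≤ z.1 := hmin (show z ∈ L ∩ {z | z.2 = 1} from ⟨hz, hz1⟩)
    have h2 : z.1 ≤ β := hmx (show z ∈ L ∩ {z | z.2 = 1} from ⟨hz, hz1⟩)
    constructor <;> linarith
  · right
    obtain rfl : β = α + 1 := by linarith
    refine ⟨α, hα, hβ, fun z hz => ⟨(hstrip z hz).2, ?_, ?_⟩⟩
    · have := hmax _ h₁ _ hβ _ hz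
      simp only [signedArea] at this
      linarith
    · have := hmax _ h₀ _ hz _ hα
      simp only [signedArea] at this
      linarith

/-- The linear map `(s, t) ↦ s • u + t • v`. -/
noncomputable def planeMap {E : Type*} [AddCommGroup E] [Module ℝ E] (u v : E) :
    ℝ × ℝ →ₗ[ℝ] E :=
  (LinearMap.fst ℝ ℝ ℝ).smulRight u + (LinearMap.snd ℝ ℝ ℝ).smulRight v

theorem planeMap_apply {E : Type*} [AddCommGroup E] [Module ℝ E] (u v : E) (z : ℝ × ℝ) :
    planeMap u v z = z.1 • u + z.2 • v := rfl

/-- `L` is a parallelogram with vertex `a` and edge vectors `u` and `v`. -/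
def IsParallelogramAt {E : Type*} [AddCommGroup E] [Module ℝ E] (L : Set E) (a u v : E) : Prop :=
  LinearIndependent ℝ ![u, v] ∧ L = convexHull ℝ {a, a + u, a + v, a + u + v}

theorem linearIndependent_pair_of_det_ne_zero {u v : ℝ × ℝ} (h : u.1 * v.2 - u.2 * v.1 ≠ 0) :
    LinearIndependent ℝ ![u, v] := by
  rw [LinearIndependent.pair_iff]
  intro s t hst
  have h1 : s * u.1 + t * v.1 = 0 := by simpa using congrArg Prod.fst hst
  have h2 : s * u.2 + t * v.2 = 0 := by simpa using congrArg Prod.snd hst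
  constructor
  · have : s * (u.1 * v.2 - u.2 * v.1) = 0 := by linear_combination v.2 * h1 - v.1 * h2
    exact (mul_eq_zero.1 this).resolve_right h
  · have : t * (u.1 * v.2 - u.2 * v.1) = 0 := by linear_combination u.1 * h2 - u.2 * h1
    exact (mul_eq_zero.1 this).resolve_right h

/-- If a triangle of maximal area inscribed in `L` has a side on the boundary of `L`, then `L` is
a parallelogram or is illuminated by three directions. -/
theorem illuminatedBy_three_or_parallelogram_of_edge {L : Set (ℝ × ℝ)} (hL : Convex ℝ L)
    (hLc : IsCompact L) {p₁ p₂ p₃ : ℝ × ℝ} (h₁ : p₁ ∈ L) (h₂ : p₂ ∈ L) (h₃ : p₃ ∈ L)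
    (hpos : 0 < signedArea p₁ p₂ p₃)
    (hmax : ∀ a ∈ L, ∀ b ∈ L, ∀ c ∈ L, signedArea a b c ≤ signedArea p₁ p₂ p₃)
    (hedge : ∀ x ∈ L, 0 ≤ signedArea p₁ p₂ x) :
    IlluminatedBy L L 3 ∨ ∃ a u v, IsParallelogramAt L a u v := by
  set D := signedArea p₁ p₂ p₃ with hD
  set e := planeMap (p₂ - p₁) (p₃ - p₁) with he
  -- Affine coordinates in which the triangle is (0,0), (1,0), (0,1); ψ multiplies signed areas by
  -- D, so maximality is preserved.
  let ψ : ℝ × ℝ → ℝ × ℝ := fun z => p₁ + e z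
  let χ : ℝ × ℝ → ℝ × ℝ := fun x => (signedArea p₁ x p₃ / D, signedArea p₁ p₂ x / D)
  have hψχ : ∀ x, ψ (χ x) = x := by
    intro x
    obtain ⟨l₁, l₂, l₃, hs, hxe, f₁, f₂, f₃⟩ := exists_barycentric hpos.ne' x
    have hχ : χ x = (l₂, l₃) := by
      simp only [χ, f₂, f₃, ← hD, mul_div_cancel_right₀ _ hpos.ne']
    obtain rfl : l₁ = 1 - l₂ - l₃ := by linarith
    rw [hχ, hxe]
    simp only [ψ, he, planeMap_apply]
    module
  have hψc : Continuous ψ := by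
    simp only [ψ, he, planeMap_apply]; fun_prop
  have hχc : Continuous χ := by
    simp only [χ, signedArea]; fun_prop
  have harea : ∀ a b c, signedArea (ψ a) (ψ b) (ψ c) = D * signedArea a b c := by
    intro a b c
    simp only [ψ, he, planeMap_apply, hD, signedArea, Prod.fst_add, Prod.snd_add, Prod.smul_fst,
      Prod.smul_snd, Prod.fst_sub, Prod.snd_sub, smul_eq_mul]
    ring
  have hψ0 : ψ (0, 0) = p₁ := by simp [ψ, he, planeMap_apply]
  have hψ1 : ψ (1, 0) = p₂ := by simp [ψ, he, planeMap_apply]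
  have hψ2 : ψ (0, 1) = p₃ := by simp [ψ, he, planeMap_apply]
  have hχψ : ∀ z, χ (ψ z) = z := by
    intro z
    have e1 := harea (0, 0) z (0, 1)
    have e2 := harea (0, 0) (1, 0) z
    rw [hψ0, hψ2] at e1
    rw [hψ0, hψ1] at e2
    simp only [χ, e1, e2, mul_div_cancel_left₀ _ hpos.ne']
    simp [signedArea]
  set L' := ψ ⁻¹' L with hL'
  have himg : L' = χ '' L := by
    ext z
    constructor
    · intro hz
      exact ⟨ψ z, hz, hχψ z⟩
    · rintro ⟨x, hx, rfl⟩
      simpa [hL', hψχ] using hx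
  have hLL' : L = ψ '' L' := by
    rw [hL', Set.image_preimage_eq L fun x => ⟨χ x, hψχ x⟩]
  have hL'c : IsCompact L' := himg ▸ hLc.image hχc
  have hL'conv : Convex ℝ L' := by
    intro x hx y hy a b ha hb hab
    have := hL hx hy ha hb hab
    simp only [hL', Set.mem_preimage]
    convert this using 1
    simp only [ψ, map_add, map_smul]
    rw [show b = 1 - a by linarith]
    module
  have m0 : ((0, 0) : ℝ × ℝ) ∈ L' := by simpa [hL', hψ0] using h₁
  have m1 : ((1, 0) : ℝ × ℝ) ∈ L' := by simpa [hL', hψ1] using h₂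
  have m2 : ((0, 1) : ℝ × ℝ) ∈ L' := by simpa [hL', hψ2] using h₃
  have hmax' : ∀ a ∈ L', ∀ b ∈ L', ∀ c ∈ L', signedArea a b c ≤ 1 := by
    intro a ha b hb c hc
    have := hmax _ ha _ hb _ hc
    rw [harea] at this
    nlinarith
  have hnonneg : ∀ z ∈ L', 0 ≤ z.2 := by
    intro z hz
    have := hedge _ hz
    rw [← hψ0, ← hψ1, harea] at this
    simp only [signedArea] at this
    have h : 0 ≤ D * z.2 := by linarith
    exact nonneg_of_mul_nonneg_right h hpos
  have hint : ∀ {M : Set (ℝ × ℝ)}, Convex ℝ M → ∀ {a b c : ℝ × ℝ}, a ∈ M → b ∈ M → c ∈ M →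
      signedArea a b c ≠ 0 → (interior M).Nonempty := fun hM _ _ _ ha hb hc h =>
    ⟨_, combo_mem_interior_of_signedArea_ne_zero hM ha hb hc h (l₁ := 1 / 3) (l₂ := 1 / 3)
      (l₃ := 1 / 3) (by norm_num) (by norm_num) (by norm_num) (by norm_num)⟩
  rcases strip_or_parallelogram hL'conv hL'c m0 m1 m2 hmax' hnonneg with h | ⟨α, ha, hb, hα⟩
  · left
    have := h.image hL'conv hL'c (hint hL'conv m0 m1 m2 (by simp [signedArea])) hL
      (hint hL h₁ h₂ h₃ hpos.ne') e p₁ fun z hz => hz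
    rwa [← hLL'] at this
  · right
    refine ⟨p₁, p₂ - p₁, e (α, 1), linearIndependent_pair_of_det_ne_zero ?_, ?_⟩
    · have : (p₂ - p₁).1 * (e (α, 1)).2 - (p₂ - p₁).2 * (e (α, 1)).1 = D := by
        simp only [he, planeMap_apply, hD, signedArea, Prod.fst_add, Prod.snd_add, Prod.smul_fst,
          Prod.smul_snd, Prod.fst_sub, Prod.snd_sub, smul_eq_mul]
        ring
      rw [this]
      exact hpos.ne'
    · have hq : p₁ + (p₂ - p₁) + e (α, 1) = ψ (α + 1, 1) := by
        simp only [ψ, he, planeMap_apply]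
        module
      have hr : p₁ + (p₂ - p₁) = p₂ := by abel
      rw [hq, hr]
      apply Set.Subset.antisymm
      · intro x hx
        have hz : χ x ∈ L' := himg ▸ Set.mem_image_of_mem χ hx
        obtain ⟨z1, z2, z3⟩ := hα _ hz
        have z0 := hnonneg _ hz
        rw [← hψχ x]
        generalize χ x = z at *
        have hmem : ∀ y ∈ ({p₁, p₂, p₁ + e (α, 1), ψ (α + 1, 1)} : Set (ℝ × ℝ)),
            y ∈ convexHull ℝ ({p₁, p₂, p₁ + e (α, 1), ψ (α + 1, 1)} : Set (ℝ × ℝ)) :=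
          fun y hy => subset_convexHull ℝ _ hy
        have hc := convex_convexHull ℝ ({p₁, p₂, p₁ + e (α, 1), ψ (α + 1, 1)} : Set (ℝ × ℝ))
        set σ := z.1 - α * z.2 with hσ
        have hbot := hc (hmem p₁ (by simp)) (hmem p₂ (by simp)) (a := 1 - σ) (b := σ)
          (by linarith) (by linarith) (by ring)
        have htop := hc (hmem (p₁ + e (α, 1)) (by simp)) (hmem (ψ (α + 1, 1)) (by simp))
          (a := 1 - σ) (b := σ) (by linarith) (by linarith) (by ring)
        have := hc hbot htop (a := 1 - z.2) (b := z.2) (by linarith) z0 (by ring)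
        convert this using 1
        simp only [ψ, he, planeMap_apply, hσ]
        module
      · refine convexHull_min ?_ hL
        rintro y (rfl | rfl | rfl | rfl)
        exacts [h₁, h₂, ha, hb]

/-- A compact convex set in the plane is a segment, or is illuminated by three directions, or is
a parallelogram. -/
theorem planar_trichotomy {L : Set (ℝ × ℝ)} (hL : Convex ℝ L) (hLc : IsCompact L)
    (hne : L.Nonempty) :
    (∃ a b, a ∈ L ∧ b ∈ L ∧ L = convexHull ℝ {a, b}) ∨
      ((interior L).Nonempty ∧ IlluminatedBy L L 3) ∨ ∃ a u v, IsParallelogramAt L a u v := by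
  obtain ⟨⟨p₁, p₂, p₃⟩, ⟨h₁, h₂, h₃⟩, hmx⟩ := (hLc.prod (hLc.prod hLc)).exists_isMaxOn
    (hne.prod (hne.prod hne))
    (f := fun q : (ℝ × ℝ) × (ℝ × ℝ) × (ℝ × ℝ) => signedArea q.1 q.2.1 q.2.2)
    (by simp only [signedArea]; fun_prop)
  simp only at h₁ h₂ h₃
  have hmax : ∀ a ∈ L, ∀ b ∈ L, ∀ c ∈ L, signedArea a b c ≤ signedArea p₁ p₂ p₃ :=
    fun a ha b hb c hc => hmx (show (a, b, c) ∈ L ×ˢ L ×ˢ L from ⟨ha, hb, hc⟩)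
  rcases le_or_gt (signedArea p₁ p₂ p₃) 0 with hz | hpos
  · left
    have hzero : ∀ a ∈ L, ∀ b ∈ L, ∀ c ∈ L, signedArea a b c = 0 := by
      intro a ha b hb c hc
      have e1 := hmax a ha b hb c hc
      have e2 := hmax a ha c hc b hb
      rw [signedArea_swap] at e2
      linarith
    -- All points are collinear here, so a pair at maximal distance consists of the endpoints of the
    -- segment.
    obtain ⟨⟨a, b⟩, ⟨ha, hb⟩, hab⟩ := (hLc.prod hLc).exists_isMaxOn (hne.prod hne)
      (f := fun q : (ℝ × ℝ) × (ℝ × ℝ) => ‖q.2 - q.1‖) (by fun_prop)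
    simp only at ha hb
    have hdist : ∀ x ∈ L, ∀ y ∈ L, ‖y - x‖ ≤ ‖b - a‖ :=
      fun x hx y hy => hab (show (x, y) ∈ L ×ˢ L from ⟨hx, hy⟩)
    refine ⟨a, b, ha, hb, Set.Subset.antisymm ?_ (convexHull_min ?_ hL)⟩
    swap
    · rintro y (rfl | rfl)
      exacts [ha, hb]
    intro z hz
    rw [convexHull_pair]
    have hcol := hzero a ha b hb z hz
    obtain ⟨τ, hτ⟩ : ∃ τ : ℝ, z - a = τ • (b - a) := by
      by_cases hba : b - a = 0
      · refine ⟨0, ?_⟩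
        have := hdist a ha z hz
        rw [hba, norm_zero] at this
        rw [zero_smul]
        exact norm_le_zero_iff.1 this
      · simp only [signedArea] at hcol
        by_cases h1 : b.1 - a.1 = 0
        · have h2 : b.2 - a.2 ≠ 0 := fun h2 => hba (Prod.ext h1 h2)
          refine ⟨(z.2 - a.2) / (b.2 - a.2), ?_⟩
          ext
          · simp only [Prod.fst_sub, Prod.smul_fst, smul_eq_mul]
            field_simp
            linear_combination -hcol
          · simp only [Prod.snd_sub, Prod.smul_snd, smul_eq_mul]
            field_simp
        · refine ⟨(z.1 - a.1) / (b.1 - a.1), ?_⟩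
          ext
          · simp only [Prod.fst_sub, Prod.smul_fst, smul_eq_mul]
            field_simp
          · simp only [Prod.snd_sub, Prod.smul_snd, smul_eq_mul]
            field_simp
            linear_combination hcol
    obtain rfl : z = a + τ • (b - a) := by rw [← hτ]; abel
    by_cases hba : b - a = 0
    · rw [hba, smul_zero, add_zero]
      exact left_mem_segment ℝ a b
    have hn : 0 < ‖b - a‖ := norm_pos_iff.2 hba
    have d1 := hdist a ha _ hz
    have d2 := hdist _ hz b hb
    rw [hτ, norm_smul, Real.norm_eq_abs] at d1
    rw [show b - (a + τ • (b - a)) = (1 - τ) • (b - a) by module, norm_smul,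
      Real.norm_eq_abs] at d2
    have t1 : |τ| ≤ 1 := by
      by_contra! hcon
      nlinarith
    have t2 : |1 - τ| ≤ 1 := by
      by_contra! hcon
      nlinarith
    rw [segment_eq_image']
    exact ⟨τ, ⟨by linarith [(abs_le.1 t2).2], (abs_le.1 t1).2⟩, rfl⟩
  · right
    have hint : (interior L).Nonempty :=
      ⟨_, combo_mem_interior_of_signedArea_ne_zero hL h₁ h₂ h₃ hpos.ne' (l₁ := 1 / 3)
        (l₂ := 1 / 3) (l₃ := 1 / 3) (by norm_num) (by norm_num) (by norm_num) (by norm_num)⟩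
    have hr := signedArea_rotate p₁ p₂ p₃
    have hr' := signedArea_rotate p₂ p₃ p₁
    by_cases e₁ : ∀ x ∈ L, 0 ≤ signedArea p₂ p₃ x
    · exact (illuminatedBy_three_or_parallelogram_of_edge hL hLc h₂ h₃ h₁ (by rwa [hr])
        (by rwa [hr]) e₁).imp_left fun h => ⟨hint, h⟩
    by_cases e₂ : ∀ x ∈ L, 0 ≤ signedArea p₃ p₁ x
    · exact (illuminatedBy_three_or_parallelogram_of_edge hL hLc h₃ h₁ h₂ (by rwa [hr', hr])
        (by rwa [hr', hr]) e₂).imp_left fun h => ⟨hint, h⟩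
    by_cases e₃ : ∀ x ∈ L, 0 ≤ signedArea p₁ p₂ x
    · exact (illuminatedBy_three_or_parallelogram_of_edge hL hLc h₁ h₂ h₃ hpos
        hmax e₃).imp_left fun h => ⟨hint, h⟩
    push Not at e₁ e₂ e₃
    obtain ⟨q₁, hq₁, e₁⟩ := e₁
    obtain ⟨q₂, hq₂, e₂⟩ := e₂
    obtain ⟨q₃, hq₃, e₃⟩ := e₃
    exact .inl ⟨hint, illuminatedBy_three_of_caps hL h₁ h₂ h₃ hpos hmax hq₁ e₁ hq₂ e₂ hq₃ e₃⟩

end Planar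

/-! ### Flat subsets of a three-dimensional body -/

section Flat

variable {E : Type*} [NormedAddCommGroup E] [NormedSpace ℝ E]

/-- A finite set of points of `K` is illuminated by one direction for each point. -/
theorem illuminatedBy_finset {K : Set E} (hKo : (interior K).Nonempty) (S : Finset E) :
    IlluminatedBy K S S.card := by
  classical
  obtain ⟨o, ho⟩ := hKo
  exact ⟨S.image fun s => o - s, Finset.card_image_le, fun s hs =>
    ⟨o - s, Finset.mem_image_of_mem _ hs, 1, one_pos, by simpa using ho⟩⟩

/-- A compact convex subset with empty interior of a convex body in a three-dimensional space is
illuminated by three directions, unless it is a parallelogram. -/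
theorem illuminatedBy_three_or_parallelogram (hE : Module.finrank ℝ E = 3)
    {K L : Set E} (hK : Convex ℝ K) (hKo : (interior K).Nonempty) (hLK : L ⊆ K)
    (hL : Convex ℝ L) (hLc : IsCompact L) (hLo : interior L = ∅) :
    IlluminatedBy K L 3 ∨ ∃ a u v, IsParallelogramAt L a u v := by
  classical
  have : FiniteDimensional ℝ E := Module.finite_of_finrank_eq_succ hE
  rcases L.eq_empty_or_nonempty with rfl | ⟨p, hp⟩
  · exact .inl ⟨∅, by simp, by simp⟩
  have hspan : vectorSpan ℝ L ≠ ⊤ := by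
    intro h
    have : affineSpan ℝ L = ⊤ :=
      (AffineSubspace.affineSpan_eq_top_iff_vectorSpan_eq_top_of_nonempty ℝ E E ⟨p, hp⟩).2 h
    rw [← hL.interior_nonempty_iff_affineSpan_eq_top, hLo] at this
    exact this.ne_empty rfl
  -- Empty interior puts L in a translate of the plane ker f, which serves as a chart for the planar
  -- result.
  obtain ⟨f, hf0, hf⟩ := Submodule.exists_le_ker_of_lt_top _ (lt_top_iff_ne_top.2 hspan)
  have hrank : Module.finrank ℝ (LinearMap.ker f) = 2 := by
    have h1 := LinearMap.finrank_range_add_finrank_ker f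
    have h2 : LinearMap.range f = ⊤ := LinearMap.range_eq_top.2 (LinearMap.surjective hf0)
    rw [h2, finrank_top, Module.finrank_self, hE] at h1
    omega
  let ε : (ℝ × ℝ) ≃ₗ[ℝ] LinearMap.ker f := LinearEquiv.ofFinrankEq _ _ (by simp [hrank])
  let e : ℝ × ℝ →ₗ[ℝ] E := (LinearMap.ker f).subtype.comp ε.toLinearMap
  have heinj : Function.Injective e := Subtype.val_injective.comp ε.injective
  let φ : ℝ × ℝ → E := fun z => p + e z
  have hφ : Topology.IsClosedEmbedding φ :=
    (Homeomorph.addLeft p).isClosedEmbedding.comp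
      (LinearMap.isClosedEmbedding_of_injective (LinearMap.ker_eq_bot.2 heinj))
  have hrange : ∀ x ∈ L, ∃ z, φ z = x := by
    intro x hx
    have hxp : x - p ∈ LinearMap.ker f := hf (vsub_mem_vectorSpan ℝ hx hp)
    refine ⟨ε.symm ⟨x - p, hxp⟩, ?_⟩
    simp [φ, e]
  have himg : L = φ '' (φ ⁻¹' L) := by
    rw [Set.image_preimage_eq_inter_range]
    exact (Set.inter_eq_left.2 fun x hx => hrange x hx).symm
  have hconv : Convex ℝ (φ ⁻¹' L) := by
    intro x hx y hy a b ha hb hab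
    have := hL hx hy ha hb hab
    simp only [Set.mem_preimage]
    convert this using 1
    simp only [φ, map_add, map_smul]
    rw [show b = 1 - a by linarith]
    module
  have hhull : ∀ s : Set (ℝ × ℝ), φ '' convexHull ℝ s = convexHull ℝ (φ '' s) := by
    intro s
    have h1 : ∀ t : Set (ℝ × ℝ), φ '' t = p +ᵥ (e '' t) := by
      intro t
      rw [← Set.image_vadd, Set.image_image]
      rfl
    rw [h1, h1, LinearMap.image_convexHull, ← convexHull_vadd]
  rcases planar_trichotomy hconv (hφ.isCompact_preimage hLc) ⟨0, by simpa [φ] using hp⟩ with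
    ⟨a, b, -, -, hab⟩ | ⟨hint, hill⟩ | ⟨a, u, v, hli, hpar⟩
  · left
    rw [himg, hab, hhull, Set.image_pair]
    have h1 := illuminatedBy_finset hKo {φ a, φ b}
    rw [Finset.coe_pair] at h1
    have hsub : {φ a, φ b} ⊆ K := by
      refine ((subset_convexHull ℝ _).trans ?_).trans hLK
      rw [himg, hab, hhull, Set.image_pair]
    exact (h1.convexHull hK hsub).mono subset_rfl (Finset.card_le_two.trans (by norm_num))
  · left
    have := hill.image hconv (hφ.isCompact_preimage hLc) hint hK hKo e p fun z hz => hLK hz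
    rwa [himg]
  · right
    refine ⟨φ a, e u, e v, ?_, ?_⟩
    · have := hli.map' e (LinearMap.ker_eq_bot.2 heinj)
      rwa [show ![e u, e v] = e ∘ ![u, v] from List.ofFn_inj.1 rfl]
    · rw [himg, hpar, hhull]
      simp only [Set.image_insert_eq, Set.image_singleton, φ, map_add, add_assoc]

end Flat

/-! ### Linear algebra of two mutually antipodal parallelograms -/

section OpposedQuads

variable {E : Type*} [AddCommGroup E]

/-- The vertices of the parallelogram with centre `c` and half edge vectors `u` and `v`. -/
def quad (c u v : E) : Set E := {c + u + v, c + u - v, c - u + v, c - u - v}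

theorem quad_swap (c u v : E) : quad c v u = quad c u v := by
  ext x
  simp only [quad, Set.mem_insert_iff, Set.mem_singleton_iff, add_right_comm c v u,
    sub_right_comm c v u, add_sub_right_comm c v u, sub_add_eq_add_sub c v u]
  tauto

theorem quad_neg_left (c u v : E) : quad c (-u) v = quad c u v := by
  ext x
  simp only [quad, Set.mem_insert_iff, Set.mem_singleton_iff, sub_neg_eq_add, ← sub_eq_add_neg]
  tauto

theorem quad_neg_right (c u v : E) : quad c u (-v) = quad c u v := by
  rw [quad_swap, quad_neg_left, quad_swap]

variable [Module ℝ E]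

/-- The sign `±1` of a Boolean. -/
def boolSign (b : Bool) : ℝ := cond b 1 (-1)

@[simp] theorem boolSign_true : boolSign true = 1 := rfl

@[simp] theorem boolSign_false : boolSign false = -1 := rfl

theorem boolSign_not (b : Bool) : boolSign (!b) = -boolSign b := by cases b <;> simp

/-- Used to choose the free signs in `cross` according to the signs of the coefficients of a linear
relation. -/
theorem exists_boolSign (a : ℝ) : ∃ e : Bool, ∀ y : ℝ, 0 ≤ boolSign e * y → 0 ≤ a * y := by
  rcases le_total 0 a with h | h
  · exact ⟨true, fun y hy => mul_nonneg h (by simpa using hy)⟩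
  · exact ⟨false, fun y hy => mul_nonneg_of_nonpos_of_nonpos h (by simpa using hy)⟩

/-- The vertices of two parallelograms with centres `c₁` and `c₂`. -/
def quadVertex (c₁ u v c₂ u' v' : E) (t : Bool × Bool × Bool) : E :=
  cond t.1 (c₂ + boolSign t.2.1 • u' + boolSign t.2.2 • v')
    (c₁ + boolSign t.2.1 • u + boolSign t.2.2 • v)

theorem range_quadVertex (c₁ u v c₂ u' v' : E) :
    Set.range (quadVertex c₁ u v c₂ u' v') = quad c₁ u v ∪ quad c₂ u' v' := by
  ext x
  simp only [Set.mem_range, Prod.exists, Bool.exists_bool, quadVertex, cond_true, cond_false,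
    boolSign_true, boolSign_false, one_smul, neg_smul, ← sub_eq_add_neg, quad, Set.mem_union,
    Set.mem_insert_iff, Set.mem_singleton_iff, eq_comm (a := x)]
  tauto

/-- The consequences for the centre difference `g` and the half edge vectors of two parallelograms
of the fact that any two of their eight vertices lie in parallel support planes of all of them. -/
structure OpposedQuads (g u v u' v' : E) : Prop where
  edge₁ : ∃ f : E →ₗ[ℝ] ℝ, f v = 0 ∧ 0 < f u ∧ |f g| + |f u'| + |f v'| ≤ f u
  edge₂ : ∃ f : E →ₗ[ℝ] ℝ, f u = 0 ∧ 0 < f v ∧ |f g| + |f u'| + |f v'| ≤ f v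
  edge₃ : ∃ f : E →ₗ[ℝ] ℝ, f v' = 0 ∧ 0 < f u' ∧ |f g| + |f u| + |f v| ≤ f u'
  edge₄ : ∃ f : E →ₗ[ℝ] ℝ, f u' = 0 ∧ 0 < f v' ∧ |f g| + |f u| + |f v| ≤ f v'
  cross : ∀ e₁ e₂ e₃ e₄ : Bool, ∃ f : E →ₗ[ℝ] ℝ, 0 ≤ boolSign e₁ * f u ∧ 0 ≤ boolSign e₂ * f v ∧
    0 ≤ boolSign e₃ * f u' ∧ 0 ≤ boolSign e₄ * f v' ∧
    |boolSign e₁ * f u + boolSign e₂ * f v - boolSign e₃ * f u' - boolSign e₄ * f v'| ≤ f g ∧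
    0 < f g + boolSign e₁ * f u + boolSign e₂ * f v + boolSign e₃ * f u' + boolSign e₄ * f v'

theorem abs_add_abs_add_abs_le {a b c d : ℝ} (h₁ : a + b + c ≤ d) (h₂ : a + b - c ≤ d)
    (h₃ : a - b + c ≤ d) (h₄ : a - b - c ≤ d) (h₅ : -d ≤ a + b + c) (h₆ : -d ≤ a + b - c)
    (h₇ : -d ≤ a - b + c) (h₈ : -d ≤ a - b - c) : |a| + |b| + |c| ≤ d := by
  rcases abs_cases a with ⟨ha, -⟩ | ⟨ha, -⟩ <;> rcases abs_cases b with ⟨hb, -⟩ | ⟨hb, -⟩ <;>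
    rcases abs_cases c with ⟨hc, -⟩ | ⟨hc, -⟩ <;> rw [ha, hb, hc] <;> linarith

/-- For the ends of an edge, a functional maximal at one and minimal at the other vanishes on the
other edge vector, and its range bounds the second parallelogram. Pairs with one vertex in each
parallelogram give `cross`. -/
theorem opposedQuads_of_antipodal {c₁ u v c₂ u' v' : E}
    (h : ∀ i j, i ≠ j → ∃ f : E →ₗ[ℝ] ℝ,
      (∀ k, f (quadVertex c₁ u v c₂ u' v' j) ≤ f (quadVertex c₁ u v c₂ u' v' k) ∧
        f (quadVertex c₁ u v c₂ u' v' k) ≤ f (quadVertex c₁ u v c₂ u' v' i)) ∧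
      f (quadVertex c₁ u v c₂ u' v' j) < f (quadVertex c₁ u v c₂ u' v' i)) :
    OpposedQuads (c₂ - c₁) u v u' v' := by
  constructor
  · obtain ⟨f, hf, hlt⟩ := h (false, true, true) (false, false, true) (by simp)
    simp only [Prod.forall, Bool.forall_bool, quadVertex, cond_true, cond_false, map_add, map_smul,
      smul_eq_mul, boolSign_true, boolSign_false] at hf hlt
    refine ⟨f, by linarith, by linarith, ?_⟩
    rw [map_sub]
    apply abs_add_abs_add_abs_le <;> linarith
  · obtain ⟨f, hf, hlt⟩ := h (false, true, true) (false, true, false) (by simp)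
    simp only [Prod.forall, Bool.forall_bool, quadVertex, cond_true, cond_false, map_add, map_smul,
      smul_eq_mul, boolSign_true, boolSign_false] at hf hlt
    refine ⟨f, by linarith, by linarith, ?_⟩
    rw [map_sub]
    apply abs_add_abs_add_abs_le <;> linarith
  · obtain ⟨f, hf, hlt⟩ := h (true, true, true) (true, false, true) (by simp)
    simp only [Prod.forall, Bool.forall_bool, quadVertex, cond_true, cond_false, map_add, map_smul,
      smul_eq_mul, boolSign_true, boolSign_false] at hf hlt
    refine ⟨f, by linarith, by linarith, ?_⟩
    rw [map_sub]
    apply abs_add_abs_add_abs_le <;> linarith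
  · obtain ⟨f, hf, hlt⟩ := h (true, true, true) (true, true, false) (by simp)
    simp only [Prod.forall, Bool.forall_bool, quadVertex, cond_true, cond_false, map_add, map_smul,
      smul_eq_mul, boolSign_true, boolSign_false] at hf hlt
    refine ⟨f, by linarith, by linarith, ?_⟩
    rw [map_sub]
    apply abs_add_abs_add_abs_le <;> linarith
  · intro e₁ e₂ e₃ e₄
    obtain ⟨f, hf, hlt⟩ := h (true, e₃, e₄) (false, !e₁, !e₂) (by simp)
    have k₁ := hf (false, e₁, e₂)
    have k₂ := hf (false, e₁, !e₂)
    have k₃ := hf (false, !e₁, e₂)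
    have k₄ := hf (true, e₃, !e₄)
    have k₅ := hf (true, !e₃, e₄)
    have k₆ := hf (true, !e₃, !e₄)
    simp only [quadVertex, cond_true, cond_false, map_add, map_smul, smul_eq_mul, boolSign_not]
      at k₁ k₂ k₃ k₄ k₅ k₆ hlt
    refine ⟨f, by linarith, by linarith, by linarith, by linarith, ?_, ?_⟩
    · rw [map_sub, abs_le]
      constructor <;> linarith
    · rw [map_sub]
      linarith

theorem OpposedQuads.swap_left {g u v u' v' : E} (h : OpposedQuads g u v u' v') :
    OpposedQuads g v u u' v' where
  edge₁ := h.edge₂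
  edge₂ := h.edge₁
  edge₃ := by
    obtain ⟨f, h1, h2, h3⟩ := h.edge₃
    exact ⟨f, h1, h2, by linarith⟩
  edge₄ := by
    obtain ⟨f, h1, h2, h3⟩ := h.edge₄
    exact ⟨f, h1, h2, by linarith⟩
  cross e₁ e₂ e₃ e₄ := by
    obtain ⟨f, h1, h2, h3, h4, h5, h6⟩ := h.cross e₂ e₁ e₃ e₄
    exact ⟨f, h2, h1, h3, h4, by rwa [add_comm (boolSign e₁ * _)], by linarith⟩

theorem OpposedQuads.swap_right {g u v u' v' : E} (h : OpposedQuads g u v u' v') :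
    OpposedQuads g u v v' u' where
  edge₁ := by
    obtain ⟨f, h1, h2, h3⟩ := h.edge₁
    exact ⟨f, h1, h2, by linarith⟩
  edge₂ := by
    obtain ⟨f, h1, h2, h3⟩ := h.edge₂
    exact ⟨f, h1, h2, by linarith⟩
  edge₃ := h.edge₄
  edge₄ := h.edge₃
  cross e₁ e₂ e₃ e₄ := by
    obtain ⟨f, h1, h2, h3, h4, h5, h6⟩ := h.cross e₁ e₂ e₄ e₃
    exact ⟨f, h1, h2, h4, h3, by rwa [sub_right_comm], by linarith⟩

/-- Opposed parallelograms with parallel planes are translates of each other. -/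
theorem OpposedQuads.quad_eq_of_mem_span {g u v u' v' : E} (h : OpposedQuads g u v u' v')
    (hu' : u' ∈ Submodule.span ℝ {u, v}) (hv' : v' ∈ Submodule.span ℝ {u, v}) (c : E) :
    quad c u' v' = quad c u v := by
  obtain ⟨α, β, rfl⟩ := Submodule.mem_span_pair.1 hu'
  obtain ⟨γ, δ, rfl⟩ := Submodule.mem_span_pair.1 hv'
  -- In the matrix of (u', v') in terms of (u, v), the absolute values in each column sum to at most
  -- 1, while each row has an entry of absolute value at least 1. Hence it is a signed permutation
  -- matrix.
  have hrow : |α| + |γ| ≤ 1 := by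
    obtain ⟨f, h1, h2, h3⟩ := h.edge₁
    simp only [map_add, map_smul, smul_eq_mul, h1, mul_zero, add_zero, abs_mul,
      abs_of_pos h2] at h3
    have := abs_nonneg (f g)
    by_contra! hcon
    nlinarith
  have hrow' : |β| + |δ| ≤ 1 := by
    obtain ⟨f, h1, h2, h3⟩ := h.edge₂
    simp only [map_add, map_smul, smul_eq_mul, h1, mul_zero, zero_add, abs_mul,
      abs_of_pos h2] at h3
    have := abs_nonneg (f g)
    by_contra! hcon
    nlinarith
  have hcol : ∀ {a b x y k : ℝ}, 0 < k → a * x + b * y = k → |x| + |y| ≤ k →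
      1 ≤ |a| ∨ 1 ≤ |b| := by
    intro a b x y k hk he hle
    by_contra! hcon
    have e1 := abs_add_le (a * x) (b * y)
    rw [he, abs_of_pos hk, abs_mul, abs_mul] at e1
    rcases (abs_nonneg x).eq_or_lt with hx | hx
    · rcases (abs_nonneg y).eq_or_lt with hy | hy
      · rw [← hx, ← hy] at e1
        linarith
      · nlinarith
    · nlinarith [abs_nonneg y]
  have hc₁ : 1 ≤ |α| ∨ 1 ≤ |β| := by
    obtain ⟨f, -, h2, h3⟩ := h.edge₃
    have := abs_nonneg (f g)
    exact hcol (x := f u) (y := f v) h2 (by simp) (by linarith)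
  have hc₂ : 1 ≤ |γ| ∨ 1 ≤ |δ| := by
    obtain ⟨f, -, h2, h3⟩ := h.edge₄
    have := abs_nonneg (f g)
    exact hcol (x := f u) (y := f v) h2 (by simp) (by linarith)
  have hα := abs_nonneg α
  have hβ := abs_nonneg β
  have hγ := abs_nonneg γ
  have hδ := abs_nonneg δ
  have hone : ∀ {a : ℝ}, 1 ≤ |a| → |a| ≤ 1 → a = 1 ∨ a = -1 := fun h1 h2 =>
    eq_or_eq_neg_of_abs_eq (le_antisymm h2 h1)
  rcases hc₁ with h1 | h1
  · obtain rfl : γ = 0 := abs_eq_zero.1 (by linarith)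
    have h2 : 1 ≤ |δ| := hc₂.resolve_left (by norm_num)
    obtain rfl : β = 0 := abs_eq_zero.1 (by linarith)
    rcases hone h1 (by linarith) with rfl | rfl <;> rcases hone h2 (by linarith) with rfl | rfl <;>
      simp [quad_neg_left, quad_neg_right]
  · obtain rfl : δ = 0 := abs_eq_zero.1 (by linarith)
    have h2 : 1 ≤ |γ| := hc₂.resolve_right (by norm_num)
    obtain rfl : α = 0 := abs_eq_zero.1 (by linarith)
    rcases hone h1 (by linarith) with rfl | rfl <;> rcases hone h2 (by linarith) with rfl | rfl <;>
      simp [quad_neg_left, quad_neg_right, quad_swap c v u]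

/-- If opposed parallelograms have a pair of parallel edges and lie in different planes, then they
have the same centre and these edges agree up to sign. -/
theorem OpposedQuads.eq_or_eq_neg_of_smul {g u v u' : E} {β x y z : ℝ}
    (h : OpposedQuads g u v u' (β • v)) (hg : g = x • u + y • v + z • u') :
    g = 0 ∧ (β • v = v ∨ β • v = -v) := by
  have hβ : |β| = 1 := by
    apply le_antisymm
    · obtain ⟨f, h1, h2, h3⟩ := h.edge₂
      simp only [map_smul, smul_eq_mul, abs_mul, abs_of_pos h2] at h3
      have := abs_nonneg (f g)
      have := abs_nonneg (f u')
      by_contra! hcon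
      nlinarith
    · obtain ⟨f, h1, h2, h3⟩ := h.edge₄
      have h4 := le_abs_self (f (β • v))
      simp only [map_smul, smul_eq_mul, abs_mul] at h2 h3 h4
      have := abs_nonneg (f g)
      have := abs_nonneg (f u)
      have : 0 < |f v| := by
        rw [abs_pos]
        rintro h0
        simp [h0] at h2
      by_contra! hcon
      nlinarith
  have hy : y = 0 := by
    obtain ⟨f, h1, h2, h3⟩ := h.edge₂
    simp only [map_smul, smul_eq_mul, abs_mul, abs_of_pos h2, hβ, one_mul] at h3
    have h4 := abs_nonneg (f g)
    have h5 := abs_nonneg (f u')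
    have hfu' : f u' = 0 := abs_eq_zero.1 (by linarith)
    have hfg : f g = 0 := abs_eq_zero.1 (by linarith)
    rw [hg] at hfg
    simp only [map_add, map_smul, smul_eq_mul, h1, hfu', mul_zero, zero_add, add_zero] at hfg
    exact (mul_eq_zero.1 hfg).resolve_right h2.ne'
  have hβ' : β = 1 ∨ β = -1 := eq_or_eq_neg_of_abs_eq hβ
  refine ⟨?_, hβ'.imp (by rintro rfl; simp) (by rintro rfl; simp)⟩
  -- These signs force f v = 0 and f g ≤ 0, while `cross` gives f g ≥ 0. Equality then makes f u and
  -- f u' nonzero and kills x and z.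
  obtain ⟨e₁, he₁⟩ := exists_boolSign (-x)
  obtain ⟨e₃, he₃⟩ := exists_boolSign (-z)
  obtain ⟨e₄, he₄⟩ := exists_boolSign (-β)
  obtain ⟨f, h1, h2, h3, h4, h5, h6⟩ := h.cross e₁ true e₃ e₄
  have hv : f v = 0 := by
    have h7 := he₄ _ h4
    simp only [boolSign_true, one_mul] at h2
    simp only [map_smul, smul_eq_mul] at h7
    have : β * β = 1 := by rcases hβ' with rfl | rfl <;> norm_num
    nlinarith
  have hfg : f g = x * f u + z * f u' := by
    rw [hg]
    simp [hv]
  simp only [map_smul, smul_eq_mul, hv, mul_zero, add_zero, sub_zero] at h5 h6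
  have h7 := he₁ _ h1
  have h8 := he₃ _ h3
  obtain ⟨h9, h10⟩ := abs_le.1 h5
  have hx : x * f u = 0 := by linarith
  have hz : z * f u' = 0 := by linarith
  have hfu : f u ≠ 0 := by
    intro h0
    rw [h0, mul_zero] at h6 h9
    linarith
  have hfu' : f u' ≠ 0 := by
    intro h0
    rw [h0, mul_zero] at h6 h10
    linarith
  rw [hg, hy, (mul_eq_zero.1 hx).resolve_right hfu, (mul_eq_zero.1 hz).resolve_right hfu']
  simp

/-- Edge vectors of opposed parallelograms in different planes have no linear relation with more
than two nonzero coefficients. -/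
theorem OpposedQuads.relation {g u v u' : E} {α β γ x y z : ℝ}
    (h : OpposedQuads g u v u' (α • u + β • v + γ • u')) (hg : g = x • u + y • v + z • u') :
    α = 0 ∧ β = 0 ∨ α = 0 ∧ γ = 0 ∨ β = 0 ∧ γ = 0 := by
  -- If one functional is nonnegative and another nonpositive on the sole remaining edge vector, the
  -- coefficient c of g along it would have to be both ≥ 1 and ≤ -1.
  have slope : ∀ {c p q r s : ℝ}, 0 ≤ 1 * p → r = c * p → |1 * p| ≤ r → 0 < r + 1 * p →
      0 ≤ -1 * q → s = c * q → |-1 * q| ≤ s → 0 < s + -1 * q → False := by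
    rintro c p q r s h1 rfl h2 h3 h4 rfl h5 h6
    have h7 := (abs_le.1 h2).2
    have h8 := (abs_le.1 h5).2
    rcases lt_or_ge c 1 with hc | hc
    · obtain rfl : p = 0 := by nlinarith
      simp at h3
    · obtain rfl : q = 0 := by nlinarith
      simp at h6
  have vanish : ∀ {a b c p q r s : ℝ}, 0 ≤ a * p → 0 ≤ b * q → 0 ≤ c * r → 0 ≤ -1 * s →
      s = a * p + b * q + c * r → s = 0 ∧ a * p = 0 ∧ b * q = 0 ∧ c * r = 0 := by
    intro a b c p q r s h1 h2 h3 h4 h5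
    refine ⟨?_, ?_, ?_, ?_⟩ <;> linarith
  -- Signs matching α, β, γ make every term of f v' nonnegative, while e₄ makes f v' nonpositive; so
  -- f vanishes on each vector that occurs in the relation.
  have key : ∀ e₁ e₂ e₃ : Bool, (∀ y, 0 ≤ boolSign e₁ * y → 0 ≤ α * y) →
      (∀ y, 0 ≤ boolSign e₂ * y → 0 ≤ β * y) → (∀ y, 0 ≤ boolSign e₃ * y → 0 ≤ γ * y) →
      ∃ f : E →ₗ[ℝ] ℝ, (α ≠ 0 → f u = 0) ∧ (β ≠ 0 → f v = 0) ∧ (γ ≠ 0 → f u' = 0) ∧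
        0 ≤ boolSign e₁ * f u ∧ 0 ≤ boolSign e₂ * f v ∧ 0 ≤ boolSign e₃ * f u' ∧
        f g = x * f u + y * f v + z * f u' ∧
        |boolSign e₁ * f u + boolSign e₂ * f v - boolSign e₃ * f u'| ≤ f g ∧
        0 < f g + boolSign e₁ * f u + boolSign e₂ * f v + boolSign e₃ * f u' := by
    intro e₁ e₂ e₃ he₁ he₂ he₃
    obtain ⟨e₄, he₄⟩ := exists_boolSign (-1)
    obtain ⟨f, h1, h2, h3, h4, h5, h6⟩ := h.cross e₁ e₂ e₃ e₄
    obtain ⟨k1, k2, k3, k4⟩ := vanish (he₁ _ h1) (he₂ _ h2) (he₃ _ h3) (he₄ _ h4) (by simp)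
    rw [k1, mul_zero] at h5 h6
    refine ⟨f, (mul_eq_zero.1 k2).resolve_left, (mul_eq_zero.1 k3).resolve_left,
      (mul_eq_zero.1 k4).resolve_left, h1, h2, h3, by rw [hg]; simp, ?_, ?_⟩
    · rwa [sub_zero] at h5
    · rwa [add_zero] at h6
  obtain ⟨e₁, he₁⟩ := exists_boolSign α
  obtain ⟨e₂, he₂⟩ := exists_boolSign β
  obtain ⟨e₃, he₃⟩ := exists_boolSign γ
  by_contra! hcon
  by_cases hα : α = 0
  · obtain ⟨f, -, p2, p3, p4, -, -, p7, p8, p9⟩ := key true e₂ e₃ (by simp [hα]) he₂ he₃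
    obtain ⟨f', -, q2, q3, q4, -, -, q7, q8, q9⟩ := key false e₂ e₃ (by simp [hα]) he₂ he₃
    simp only [boolSign_true, boolSign_false, p2 (hcon.1 hα), p3 (hcon.2.1 hα), q2 (hcon.1 hα),
      q3 (hcon.2.1 hα), mul_zero, add_zero, sub_zero] at p4 p7 p8 p9 q4 q7 q8 q9
    exact slope p4 p7 p8 p9 q4 q7 q8 q9
  by_cases hβ : β = 0
  · obtain ⟨f, p1, -, p3, -, p4, -, p7, p8, p9⟩ := key e₁ true e₃ he₁ (by simp [hβ]) he₃
    obtain ⟨f', q1, -, q3, -, q4, -, q7, q8, q9⟩ := key e₁ false e₃ he₁ (by simp [hβ]) he₃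
    simp only [boolSign_true, boolSign_false, p1 hα, p3 (hcon.2.2 hβ), q1 hα,
      q3 (hcon.2.2 hβ), mul_zero, add_zero, sub_zero, zero_add] at p4 p7 p8 p9 q4 q7 q8 q9
    exact slope p4 p7 p8 p9 q4 q7 q8 q9
  by_cases hγ : γ = 0
  · obtain ⟨f, p1, p2, -, -, -, p4, p7, p8, p9⟩ := key e₁ e₂ true he₁ he₂ (by simp [hγ])
    obtain ⟨f', q1, q2, -, -, -, q4, q7, q8, q9⟩ := key e₁ e₂ false he₁ he₂ (by simp [hγ])
    simp only [boolSign_true, boolSign_false, p1 hα, p2 hβ, q1 hα, q2 hβ, mul_zero, add_zero,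
      zero_sub, zero_add, abs_neg] at p4 p7 p8 p9 q4 q7 q8 q9
    exact slope p4 p7 p8 p9 q4 q7 q8 q9
  · obtain ⟨f, p1, p2, p3, -, -, -, p7, -, p9⟩ := key e₁ e₂ e₃ he₁ he₂ he₃
    rw [p7, p1 hα, p2 hβ, p3 hγ] at p9
    simp at p9

end OpposedQuads

/-! ### Antipodality from the failure of illumination -/

section Antipodal

variable {E : Type*} [NormedAddCommGroup E] [NormedSpace ℝ E]

/-- If a body spanned by finitely many points is not illuminated with fewer directions than there
are points, then any two of the points lie in parallel support planes. -/
theorem exists_antipodal_functional {ι : Type*} [Fintype ι] {K : Set E} (hK : Convex ℝ K)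
    (hKo : (interior K).Nonempty) {s : ι → E} (hs : K = convexHull ℝ (Set.range s))
    (hill : ¬ IlluminatedBy K K (Fintype.card ι - 1)) {i j : ι} (hij : i ≠ j) :
    ∃ f : E →ₗ[ℝ] ℝ, (∀ k, f (s j) ≤ f (s k) ∧ f (s k) ≤ f (s i)) ∧ f (s j) < f (s i) := by
  classical
  have hsK : ∀ k, s k ∈ K := fun k => hs ▸ subset_convexHull ℝ _ ⟨k, rfl⟩
  obtain ⟨o, ho⟩ := hKo
  -- A common point of these sets is a direction illuminating both s i and s j, which would save one
  -- direction.
  have hdisj : Disjoint (-s i +ᵥ interior K) (-s j +ᵥ interior K) := by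
    rw [Set.disjoint_left]
    rintro d ⟨x, hx, rfl⟩ ⟨y, hy, hxy⟩
    simp only [vadd_eq_add] at hxy
    refine hill ?_
    have hS : IlluminatedBy K (Set.range s) (Fintype.card ι - 1) := by
      refine ⟨(Finset.univ.erase i).image fun k => if k = j then -s i + x else o - s k,
        Finset.card_image_le.trans (by simp [Finset.card_erase_of_mem]), ?_⟩
      rintro _ ⟨k, rfl⟩
      by_cases hki : k = i ∨ k = j
      · refine ⟨-s i + x, Finset.mem_image.2 ⟨j, by simp [hij.symm], by simp⟩, 1, one_pos, ?_⟩
        rcases hki with rfl | rfl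
        · simpa using hx
        · rw [← hxy]
          simpa using hy
      · push Not at hki
        exact ⟨o - s k, Finset.mem_image.2 ⟨k, by simp [hki.1], by simp [hki.2]⟩, 1, one_pos,
          by simpa using ho⟩
    have := hS.convexHull hK (by rintro _ ⟨k, rfl⟩; exact hsK k)
    rwa [← hs] at this
  obtain ⟨f, c, hf₁, hf₂⟩ := geometric_hahn_banach_open_open (hK.interior.vadd _)
    (isOpen_interior.vadd _) (hK.interior.vadd _) (isOpen_interior.vadd _) hdisj
  have hf₁' : ∀ x ∈ interior K, f x < c + f (s i) := fun x hx => by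
    have := hf₁ _ ⟨x, hx, rfl⟩
    simp only [vadd_eq_add, map_add, map_neg] at this
    linarith
  have hf₂' : ∀ x ∈ interior K, c + f (s j) < f x := fun x hx => by
    have := hf₂ _ ⟨x, hx, rfl⟩
    simp only [vadd_eq_add, map_add, map_neg] at this
    linarith
  have hcl : K ⊆ closure (interior K) := by
    rw [hK.closure_interior_eq_closure_of_nonempty_interior ⟨o, ho⟩]
    exact subset_closure
  have hle₁ : ∀ x ∈ K, f x ≤ c + f (s i) := fun x hx =>
    closure_minimal (fun y hy => (hf₁' y hy).le)
      (isClosed_le f.continuous continuous_const) (hcl hx)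
  have hle₂ : ∀ x ∈ K, c + f (s j) ≤ f x := fun x hx =>
    closure_minimal (fun y hy => (hf₂' y hy).le)
      (isClosed_le continuous_const f.continuous) (hcl hx)
  -- Evaluating the two bounds at s i and s j themselves gives c ≥ 0 and c ≤ 0.
  have hc : c = 0 := by
    have h1 := hle₁ _ (hsK i)
    have h2 := hle₂ _ (hsK j)
    linarith
  subst hc
  simp only [zero_add] at *
  exact ⟨f.toLinearMap, fun k => ⟨hle₂ _ (hsK k), hle₁ _ (hsK k)⟩,
    (hf₂' o ho).trans (hf₁' o ho)⟩

theorem Submodule.eq_top_of_subset_vadd {K : Set E} (hKo : (interior K).Nonempty)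
    {S : Submodule ℝ E} {p : E} (h : ∀ x ∈ K, x - p ∈ S) : S = ⊤ := by
  refine Submodule.eq_top_of_nonempty_interior' S ?_
  obtain ⟨o, ho⟩ := hKo
  refine ⟨-p + o, interior_maximal (s := (S : Set E)) (t := -p +ᵥ interior K) ?_
    (isOpen_interior.vadd _) ⟨o, ho, rfl⟩⟩
  rintro _ ⟨x, hx, rfl⟩
  simpa [sub_eq_neg_add] using h x (interior_subset hx)

theorem isParallelogramAt_eq_convexHull_quad {L : Set E} {a u v : E}
    (h : IsParallelogramAt L a u v) :
    ∃ c u' v' : E, LinearIndependent ℝ ![u', v'] ∧ L = convexHull ℝ (quad c u' v') := by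
  obtain ⟨hli, rfl⟩ := h
  refine ⟨a + (1 / 2 : ℝ) • u + (1 / 2 : ℝ) • v, (1 / 2 : ℝ) • u, (1 / 2 : ℝ) • v, ?_, ?_⟩
  · rw [LinearIndependent.pair_iff] at hli ⊢
    intro s t hst
    have := hli (s * (1 / 2)) (t * (1 / 2)) (by simpa only [mul_smul] using hst)
    constructor <;> linarith
  · congr 1
    have e1 : a + (1 / 2 : ℝ) • u + (1 / 2 : ℝ) • v + (1 / 2 : ℝ) • u + (1 / 2 : ℝ) • v =
      a + u + v := by module
    have e2 : a + (1 / 2 : ℝ) • u + (1 / 2 : ℝ) • v + (1 / 2 : ℝ) • u - (1 / 2 : ℝ) • v =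
      a + u := by module
    have e3 : a + (1 / 2 : ℝ) • u + (1 / 2 : ℝ) • v - (1 / 2 : ℝ) • u + (1 / 2 : ℝ) • v =
      a + v := by module
    have e4 : a + (1 / 2 : ℝ) • u + (1 / 2 : ℝ) • v - (1 / 2 : ℝ) • u - (1 / 2 : ℝ) • v =
      a := by module
    ext x
    simp only [quad, e1, e2, e3, e4, Set.mem_insert_iff, Set.mem_singleton_iff]
    tauto

end Antipodal

/-! ### Recognising parallelepipeds and counting their vertices -/

section Parallelepiped

/-- The convex hull of two opposite translates of the vertices of a parallelogram is a
parallelepiped. -/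
theorem isParallelepiped_of_translates {K : Set (EuclideanSpace ℝ (Fin 3))}
    (hKo : (interior K).Nonempty) {c₁ c₂ u v : EuclideanSpace ℝ (Fin 3)}
    (hK : K = convexHull ℝ (quad c₁ u v ∪ quad c₂ u v)) : IsParallelepiped K := by
  let w : Fin 3 → EuclideanSpace ℝ (Fin 3) := ![c₂ - c₁, (2 : ℝ) • u, (2 : ℝ) • v]
  have hKw : K = (c₁ - u - v) +ᵥ parallelepiped w := by
    rw [hK, parallelepiped_eq_convexHull, ← convexHull_vadd]
    congr 1
    have hsum : ∑ i, ({0, w i} : Set (EuclideanSpace ℝ (Fin 3))) =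
        {0, c₂ - c₁} + {0, (2 : ℝ) • u} + {0, (2 : ℝ) • v} := by
      simp [Fin.sum_univ_three, w]
    rw [hsum]
    have e1 : c₁ - u - v + (0 + 0 + 0) = c₁ - u - v := by module
    have e2 : c₁ - u - v + (0 + 0 + (2 : ℝ) • v) = c₁ - u + v := by module
    have e3 : c₁ - u - v + (0 + (2 : ℝ) • u + 0) = c₁ + u - v := by module
    have e4 : c₁ - u - v + (0 + (2 : ℝ) • u + (2 : ℝ) • v) = c₁ + u + v := by module
    have e5 : c₁ - u - v + (c₂ - c₁ + 0 + 0) = c₂ - u - v := by module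
    have e6 : c₁ - u - v + (c₂ - c₁ + 0 + (2 : ℝ) • v) = c₂ - u + v := by module
    have e7 : c₁ - u - v + (c₂ - c₁ + (2 : ℝ) • u + 0) = c₂ + u - v := by module
    have e8 : c₁ - u - v + (c₂ - c₁ + (2 : ℝ) • u + (2 : ℝ) • v) = c₂ + u + v := by module
    ext x
    simp only [quad, Set.insert_eq, Set.union_add, Set.add_union, Set.singleton_add_singleton,
      Set.vadd_set_union, Set.vadd_set_singleton, vadd_eq_add, e1, e2, e3, e4, e5, e6, e7, e8,
      Set.mem_union, Set.mem_singleton_iff]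
    tauto
  refine ⟨c₁ - u - v, w, ?_, hKw⟩
  refine linearIndependent_of_top_le_span_of_card_eq_finrank (top_le_iff.2 ?_) (by simp)
  refine Submodule.eq_top_of_subset_vadd hKo (p := c₁ - u - v) fun x hx => ?_
  rw [hKw] at hx
  obtain ⟨y, hy, rfl⟩ := hx
  obtain ⟨t, -, rfl⟩ := (mem_parallelepiped_iff _ _).1 hy
  simp only [vadd_eq_add, add_sub_cancel_left]
  exact Submodule.sum_mem _ fun i _ => Submodule.smul_mem _ _ (Submodule.subset_span ⟨i, rfl⟩)

/-- Two diagonal sections with a common centre and a common pair of edges span a parallelepiped. -/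
theorem isParallelepiped_of_diagonal_sections {K : Set (EuclideanSpace ℝ (Fin 3))}
    (hKo : (interior K).Nonempty) {c u v w : EuclideanSpace ℝ (Fin 3)}
    (hK : K = convexHull ℝ (quad c u v ∪ quad c w v)) : IsParallelepiped K := by
  -- The eight vertices are regrouped into the two opposite faces centred at c ± v, with diagonals
  -- along u and w.
  refine isParallelepiped_of_translates hKo (c₁ := c + v) (c₂ := c - v)
    (u := (1 / 2 : ℝ) • (u + w)) (v := (1 / 2 : ℝ) • (u - w)) ?_
  rw [hK]
  congr 1
  have e1 : ∀ p : EuclideanSpace ℝ (Fin 3),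
      p + (1 / 2 : ℝ) • (u + w) + (1 / 2 : ℝ) • (u - w) = p + u := fun p => by module
  have e2 : ∀ p : EuclideanSpace ℝ (Fin 3),
      p + (1 / 2 : ℝ) • (u + w) - (1 / 2 : ℝ) • (u - w) = p + w := fun p => by module
  have e3 : ∀ p : EuclideanSpace ℝ (Fin 3),
      p - (1 / 2 : ℝ) • (u + w) + (1 / 2 : ℝ) • (u - w) = p - w := fun p => by module
  have e4 : ∀ p : EuclideanSpace ℝ (Fin 3),
      p - (1 / 2 : ℝ) • (u + w) - (1 / 2 : ℝ) • (u - w) = p - u := fun p => by module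
  ext x
  simp only [quad, e1, e2, e3, e4, Set.mem_union, Set.mem_insert_iff, Set.mem_singleton_iff]
  simp only [add_right_comm c v, sub_right_comm c v, add_sub_right_comm c v,
    sub_add_eq_add_sub c v]
  tauto

/-- Parallel planes give translated faces. Otherwise u, v and one edge vector of the second
parallelogram form a basis, and `OpposedQuads.relation` makes its other edge vector a multiple of u
or v, giving two diagonal sections. -/
theorem isParallelepiped_of_not_illuminatedBy_seven {K : Set (EuclideanSpace ℝ (Fin 3))}
    (hK : Convex ℝ K) (hKo : (interior K).Nonempty) {c₁ u v c₂ u' v' : EuclideanSpace ℝ (Fin 3)}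
    (hli : LinearIndependent ℝ ![u, v]) (hli' : LinearIndependent ℝ ![u', v'])
    (hKq : K = convexHull ℝ (quad c₁ u v ∪ quad c₂ u' v')) (hill : ¬ IlluminatedBy K K 7) :
    IsParallelepiped K := by
  have hopp : OpposedQuads (c₂ - c₁) u v u' v' := by
    refine opposedQuads_of_antipodal fun i j hij => ?_
    exact exists_antipodal_functional hK hKo (by rw [hKq, range_quadVertex]) (by simpa using hill)
      hij
  clear hill
  have main : ∀ u' v' : EuclideanSpace ℝ (Fin 3), LinearIndependent ℝ ![u', v'] →
      K = convexHull ℝ (quad c₁ u v ∪ quad c₂ u' v') → OpposedQuads (c₂ - c₁) u v u' v' →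
      u' ∉ Submodule.span ℝ {u, v} → IsParallelepiped K := by
    clear hli' hKq hopp u' v'
    intro u' v' hli' hKq hopp hu'
    have hli3 : LinearIndependent ℝ ![u', u, v] := by
      refine linearIndependent_finCons.2 ?_
      exact ⟨hli, by simpa [Matrix.range_cons, Set.pair_comm] using hu'⟩
    have hspan : ∀ p : EuclideanSpace ℝ (Fin 3), ∃ α β γ : ℝ,
        p = α • u + β • v + γ • u' := by
      intro p
      have htop := hli3.span_eq_top_of_card_eq_finrank (by simp)
      have hp : p ∈ Submodule.span ℝ (Set.range ![u', u, v]) := htop ▸ Submodule.mem_top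
      obtain ⟨c, rfl⟩ := (Submodule.mem_span_range_iff_exists_fun ℝ).1 hp
      refine ⟨c 1, c 2, c 0, ?_⟩
      simp only [Fin.sum_univ_three, Matrix.cons_val]
      abel
    obtain ⟨x, y, z, hg⟩ := hspan (c₂ - c₁)
    obtain ⟨α, β, γ, rfl⟩ := hspan v'
    rcases hopp.relation hg with ⟨rfl, rfl⟩ | ⟨rfl, rfl⟩ | ⟨rfl, rfl⟩
    · rw [LinearIndependent.pair_iff] at hli'
      have := (hli' γ (-1) (by simp)).2
      norm_num at this
    · simp only [zero_smul, zero_add, add_zero] at hopp hKq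
      obtain ⟨h0, hv⟩ := hopp.eq_or_eq_neg_of_smul hg
      obtain rfl : c₂ = c₁ := sub_eq_zero.1 h0
      refine isParallelepiped_of_diagonal_sections hKo (c := c₂) (u := u) (v := v) (w := u') ?_
      rcases hv with hv | hv <;> simpa only [hv, quad_neg_right] using hKq
    · simp only [zero_smul, add_zero] at hopp hKq
      obtain ⟨h0, hv⟩ := hopp.swap_left.eq_or_eq_neg_of_smul
        (x := y) (y := x) (z := z) (by rw [hg]; abel)
      obtain rfl : c₂ = c₁ := sub_eq_zero.1 h0
      refine isParallelepiped_of_diagonal_sections hKo (c := c₂) (u := v) (v := u) (w := u') ?_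
      rw [quad_swap]
      rcases hv with hv | hv <;> simpa only [hv, quad_neg_right] using hKq
  by_cases hu' : u' ∈ Submodule.span ℝ {u, v}
  · by_cases hv' : v' ∈ Submodule.span ℝ {u, v}
    · rw [hopp.quad_eq_of_mem_span hu' hv'] at hKq
      exact isParallelepiped_of_translates hKo hKq
    · refine main v' u' ?_ (by rwa [quad_swap c₂ u' v']) hopp.swap_right hv'
      exact LinearIndependent.pair_symm_iff.1 hli'
  · exact main u' v' hli' hKq hopp hu'

/-- No translate of the interior of a parallelepiped contains two of its vertices. -/
theorem eight_le_coveringNumber_of_isParallelepiped {K : Set (EuclideanSpace ℝ (Fin 3))}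
    (hK : IsConvexBody K) (h : IsParallelepiped K) : 8 ≤ coveringNumber K := by
  classical
  obtain ⟨p, v, hli, hKv⟩ := h
  let b := basisOfLinearIndependentOfCardEqFinrank hli (by simp)
  have hb : ⇑b = v := coe_basisOfLinearIndependentOfCardEqFinrank hli (by simp)
  let vert : (Fin 3 → Bool) → EuclideanSpace ℝ (Fin 3) := fun t =>
    p + ∑ i, (cond (t i) 1 0 : ℝ) • v i
  have hcoordv : ∀ t : Fin 3 → ℝ, ∀ i, b.coord i (∑ j, t j • v j) = t i := by
    intro t i
    rw [← hb]
    rw [Module.Basis.coord_apply, b.repr_sum_self]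
  have hvert : ∀ t, vert t ∈ K := by
    intro t
    rw [hKv]
    refine ⟨_, (mem_parallelepiped_iff _ _).2 ⟨fun i => cond (t i) 1 0, ?_, rfl⟩, rfl⟩
    constructor <;> intro i <;> cases h : t i <;> simp [h]
  have hcoordK : ∀ i, ∀ x ∈ K, b.coord i p ≤ b.coord i x ∧ b.coord i x ≤ b.coord i p + 1 := by
    intro i x hx
    rw [hKv] at hx
    obtain ⟨y, hy, rfl⟩ := hx
    obtain ⟨t, ht, rfl⟩ := (mem_parallelepiped_iff _ _).1 hy
    simp only [vadd_eq_add, map_add, hcoordv]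
    exact ⟨by linarith [ht.1 i, show (0 : Fin 3 → ℝ) i = 0 from rfl],
      by linarith [ht.2 i, show (1 : Fin 3 → ℝ) i = 1 from rfl]⟩
  -- An interior point can move slightly along ±v i within K, so its coordinate bounds are strict.
  have hcoordint : ∀ i, ∀ x ∈ interior K,
      b.coord i p < b.coord i x ∧ b.coord i x < b.coord i p + 1 := by
    intro i x hx
    have hcont : Continuous fun s : ℝ => x + s • v i := by fun_prop
    have hev : ∀ᶠ s in nhds (0 : ℝ), x + s • v i ∈ interior K :=
      hcont.continuousAt.eventually (isOpen_interior.eventually_mem (by simpa using hx))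
    obtain ⟨ε, hε, hball⟩ := Metric.eventually_nhds_iff.1 hev
    have hci : b.coord i (v i) = 1 := by rw [← hb]; simp
    have h1 := hcoordK i _ (interior_subset (hball (y := ε / 2)
      (by rw [Real.dist_0_eq_abs, abs_of_pos (by linarith)]; linarith)))
    have h2 := hcoordK i _ (interior_subset (hball (y := -(ε / 2))
      (by rw [Real.dist_0_eq_abs, abs_neg, abs_of_pos (by linarith)]; linarith)))
    simp only [map_add, map_smul, hci, smul_eq_mul, mul_one] at h1 h2
    constructor <;> linarith
  refine le_iInf₂ fun 𝒞 h𝒞 => ?_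
  have hch : ∀ t, ∃ C ∈ 𝒞, vert t ∈ C := fun t => h𝒞.2 (hvert t)
  choose C hC hmem using hch
  -- Distinct vertices differ by exactly 1 in some coordinate, but a translate of the interior has
  -- open width 1 there.
  have hinj : Function.Injective C := by
    intro t t' htt
    by_contra hne
    obtain ⟨i, hi⟩ := Function.ne_iff.1 hne
    obtain ⟨x, hx⟩ := h𝒞.1 _ (hC t)
    have m1 := hmem t
    have m2 := hmem t'
    rw [← htt] at m2
    rw [hx, hK.intrinsicInterior_eq] at m1 m2
    obtain ⟨y, hy, hy'⟩ := m1
    obtain ⟨z, hz, hz'⟩ := m2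
    obtain ⟨a1, a2⟩ := hcoordint i y hy
    obtain ⟨b1, b2⟩ := hcoordint i z hz
    have c1 := congrArg (b.coord i) hy'
    have c2 := congrArg (b.coord i) hz'
    simp only [vert, vadd_eq_add, map_add, hcoordv] at c1 c2
    cases h1 : t i <;> cases h2 : t' i <;> simp only [h1, h2, cond_true, cond_false] at c1 c2 hi
    · exact hi rfl
    · linarith
    · linarith
    · exact hi rfl
  calc (8 : ℕ∞) = (Set.univ : Set (Fin 3 → Bool)).encard := by
        rw [Set.encard_univ]; simp
    _ = (Set.range C).encard := by rw [← Set.image_univ, hinj.encard_image]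
    _ ≤ 𝒞.encard := Set.encard_le_encard (by rintro _ ⟨t, rfl⟩; exact hC t)

end Parallelepiped

/-! ### Assembly of the theorem -/

theorem mainTheorem1 (K L M : Set (EuclideanSpace ℝ (Fin 3)))
    (hK : IsConvexBody K)
    (hLcompact : IsCompact L) (hLconvex : Convex ℝ L) (hLint : interior L = ∅)
    (hMcompact : IsCompact M) (hMconvex : Convex ℝ M) (hMint : interior M = ∅)
    (hKLM : K = convexHull ℝ (L ∪ M)) :
    coveringNumber K = homotheticCoveringNumber K ∧
      coveringNumber K ≤ 8 ∧
      (coveringNumber K = 8 ↔ IsParallelepiped K) := by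
  classical
  have hLMK : L ∪ M ⊆ K := hKLM ▸ subset_convexHull ℝ _
  have hLK : L ⊆ K := Set.subset_union_left.trans hLMK
  have hMK : M ⊆ K := Set.subset_union_right.trans hLMK
  have hrank : Module.finrank ℝ (EuclideanSpace ℝ (Fin 3)) = 3 := by simp
  have hfour : ∀ N ⊆ K, (∃ a u v, IsParallelogramAt N a u v) → IlluminatedBy K N 4 := by
    rintro N hN ⟨a, u, v, -, rfl⟩
    have h := illuminatedBy_finset hK.nonempty_interior {a, a + u, a + v, a + u + v}
    refine (h.mono (n := 4) (A := {a, a + u, a + v, a + u + v}) (by simp)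
      Finset.card_le_four).convexHull hK.convex ((subset_convexHull ℝ _).trans hN)
  have hcomb : ∀ m n, IlluminatedBy K L m → IlluminatedBy K M n → IlluminatedBy K K (m + n) := by
    intro m n h1 h2
    have := (h1.union h2).convexHull hK.convex hLMK
    rwa [← hKLM] at this
  have hseven : ∀ {m : ℕ}, m ≤ 7 → IlluminatedBy K K m → coveringNumber K ≠ 8 := by
    intro m hm h h8
    have := hK.coveringNumber_le h
    rw [h8] at this
    have : 8 ≤ m := by exact_mod_cast this
    omega
  have hLcase := illuminatedBy_three_or_parallelogram hrank hK.convex hK.nonempty_interior hLK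
    hLconvex hLcompact hLint
  have hMcase := illuminatedBy_three_or_parallelogram hrank hK.convex hK.nonempty_interior hMK
    hMconvex hMcompact hMint
  have hL4 : IlluminatedBy K L 4 :=
    hLcase.elim (fun h => h.mono subset_rfl (by norm_num)) (hfour L hLK)
  have hM4 : IlluminatedBy K M 4 :=
    hMcase.elim (fun h => h.mono subset_rfl (by norm_num)) (hfour M hMK)
  have hle : coveringNumber K ≤ 8 := by
    exact_mod_cast hK.coveringNumber_le (hcomb 4 4 hL4 hM4)
  refine ⟨hK.coveringNumber_eq_homotheticCoveringNumber, hle, fun h8 => ?_, fun h =>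
    le_antisymm hle (eight_le_coveringNumber_of_isParallelepiped hK h)⟩
  -- If either set needs only three directions, 3 + 4 = 7 suffice for K, contradicting c(K) = 8.
  rcases hLcase with hL3 | ⟨a, u, v, hL⟩
  · exact (hseven (by norm_num) (hcomb 3 4 hL3 hM4) h8).elim
  rcases hMcase with hM3 | ⟨a', u', v', hM⟩
  · exact (hseven (by norm_num) (hcomb 4 3 hL4 hM3) h8).elim
  obtain ⟨c₁, w₁, z₁, hli, rfl⟩ := isParallelogramAt_eq_convexHull_quad hL
  obtain ⟨c₂, w₂, z₂, hli', rfl⟩ := isParallelogramAt_eq_convexHull_quad hM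
  rw [convexHull_convexHull_union_left, convexHull_convexHull_union_right] at hKLM
  exact isParallelepiped_of_not_illuminatedBy_seven hK.convex hK.nonempty_interior hli hli' hKLM
    fun h => hseven le_rfl h h8
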